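/- **Setting.** Let $H$ be a separable complex Hilbert space, $A=qU$ with $q\in\mathbb C\setminus\{0\}$ and $U$ unitary, and let $r>0$ be the real with $A^*A=AA^*=rI$. Let $\varphi\in H$ with $\|\varphi\|=1$ be cyclic, i.e. $\{P(A,A^*)\varphi : P\in\mathbb C[X,Y]\}$ is dense in $H$. Fix a natural number $M>\max(\|A\|,\sqrt r)$, let $S=\{\lambda\in\mathbb C: |\mathrm{Re}\,\lambda|\le M,\ |\mathrm{Im}\,\lambda|\le M\}$, and fix an ultrafilter $D$ on $\mathbb N$ that contains $\{N\ne 0:\sqrt N\in\mathbb N,\ m\mid\sqrt N\}$ for every $m\ge1$. **Approximations.** For $N\in\mathbb N$ let $H_N$, $H_N^-$, $H_N^+$ be the spans of the vectors $A^i(A^*)^j\varphi$ with, respectively, $i,j\le N$; $i<N,\ j\le N$; $0<i\le N,\ j\le N$. Let $W_N^{\pm}$ be the orthogonal complement of $H_N^{\pm}$ in $H_N$. Choose a unitary $V_N:W_N^-\to W_N^+$, and let $A_N:H_N\to H_N$ be the linear operator equal to $A$ on $H_N^-$ and to $\sqrt r\,V_N$ on $W_N^-$. Choose an orthonormal basis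 $u_N(n)$, $n<\dim H_N$, of $H_N$ consisting of eigenvectors of $A_N$, with eigenvalues $\lambda_N(n)$, such that $\xi_N(n)=\langle u_N(n)|\varphi\rangle$ is a non-negative real for all $n$ (inner products are linear in the second variable). **Ultraproduct.** Let $H^m$ be the metric ultraproduct of the $H_N$: the sequences $(v_N)$, $v_N\in H_N$, with $\|v_N\|$ bounded on a set in $D$, modulo the sequences with $\lim_D\|v_N\|=0$; the inner product is the ultralimit of the inner products. Write $[(v_N)]$ for the class of $(v_N)$; finitely many entries do not matter. Let $A^m[(v_N)]=[(A_Nv_N)]$. Let $G^m:H\to H^m$ be the continuous linear map determined by $G^m(P(A,A^*)\varphi)=[(P(A,A^*)\varphi)_N]$ for $P\in\mathbb C[X,Y]$ (this vector lies in $H_N$ for all large $N$), and let $H^{Im}\subseteq H^m$ be its range. **Measure.** Let $\mu_N(X)=\sum_{n:\lambda_N(n)\in X}\xi_N(n)^2$ and $\mu^n(X)=\lim_D\mu_N(X)$ for $X\subseteq\mathbb C$. A real $t\in[-M,M]$ is nice if for every $\delta>0$ there is $\varepsilon>0$ such that $\mu^n(\{\lambda\in S:|\mathrm{Re}\,\lambda-t|<\varepsilon\})<\delta$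 and $\mu^n(\{\lambda\in S:|\mathrm{Im}\,\lambda-t|<\varepsilon\})<\delta$. Choose a countable dense subset $NI$ of $[-M,M]$ that consists of nice reals and contains $\pm M$. Let $Sq^*$ be the family of the sets $\{\lambda\in S:r_0<\mathrm{Re}\,\lambda<r_1,\ r_2<\mathrm{Im}\,\lambda<r_3\}$ with $r_i\in NI$. For $X\subseteq\mathbb C$ let $\mu^*(X)=\inf\sum_{i}\mu^n(X_i)$ over all countable covers of $X\cap\mathrm{Int}(S)$ by sets $X_i\in Sq^*$. **Statement.** Choices as above of $V_N$, $u_N(n)$ exist, and for all such choices the following holds. Each $A_N$ is normal, with $A_N^*A_N=A_NA_N^*=rI$. A set $NI$ as above exists, and for every such $NI$: 1. All Borel sets are Carathéodory measurable for $\mu^*$, so $\mu^*$ restricts to a Borel measure $\mu$ on $S$. 2. For $P\in\mathbb C[X,Y]$ let $f_P(\lambda)=P(\lambda,\overline\lambda)$. The rules $f_P\mapsto[(\sum_{n}\xi_N(n)f_P(\lambda_N(n))u_N(n))_N]$ and $f_P\mapsto f_{XP}$ extend by continuity to continuous linear maps $F^m:L_2(S,\mu)\to H^m$ and $A_D:L_2(S,\mu)\to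 L_2(S,\mu)$, the map $G^m$ is well defined, and $(A_Df)(\lambda)=\lambda f(\lambda)$ for $\mu$-almost all $\lambda$. 3. $F^m$ is an isometric isomorphism from $L_2(S,\mu)$ onto $H^{Im}$, and $A^m\restriction H^{Im}=F^mA_D(F^m)^{-1}$. 4. $G^m$ is an isometric isomorphism from $H$ onto $H^{Im}$, so $G=(G^m)^{-1}F^m$ is an isometric isomorphism from $L_2(S,\mu)$ to $H$, and $A=GA_DG^{-1}$. -/

import Mathlib

open MeasureTheory Filter Topology
open scoped ENNReal ComplexConjugate

noncomputable section

/-! ### Metric ultraproducts of complex inner product spaces -/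

namespace MetricUltra

section Lim

variable (D : Ultrafilter ℕ)

/-- A complex sequence is finite (along `D`) if it is bounded on a set in `D`. -/
def IsFin (a : ℕ → ℂ) : Prop := ∃ C : ℝ, ∀ᶠ N in (D : Filter ℕ), ‖a N‖ ≤ C

/-- The ultralimit of a complex sequence: the `q` that is infinitely close to it along `D`. -/
def ulim (a : ℕ → ℂ) : ℂ := limUnder (D : Filter ℕ) a

variable {D}

theorem tendsto_ulim {a : ℕ → ℂ} (ha : IsFin D a) : Tendsto a D (𝓝 (ulim D a)) := by
  obtain ⟨C, hC⟩ := ha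
  have hmem : (D.map a : Filter ℂ) ≤ 𝓟 (Metric.closedBall 0 C) := by
    rw [le_principal_iff]
    exact hC.mono fun N hN => by simpa using hN
  obtain ⟨x, -, hx⟩ := (isCompact_closedBall (0 : ℂ) C).ultrafilter_le_nhds (D.map a) hmem
  exact tendsto_nhds_limUnder ⟨x, hx⟩

theorem ulim_eq {a : ℕ → ℂ} {q : ℂ} (h : Tendsto a D (𝓝 q)) : ulim D a = q := h.limUnder_eq

end Lim

variable (D : Ultrafilter ℕ) (E : ℕ → Type*)
  [∀ N, NormedAddCommGroup (E N)] [∀ N, InnerProductSpace ℂ (E N)]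

/-- The sequences `(v_N)` whose norm is finite along `D`, i.e. `{N | ‖v_N‖ ≤ C} ∈ D` for
some `C`. -/
def finSub : Submodule ℂ (∀ N, E N) where
  carrier := {v | ∃ C : ℝ, ∀ᶠ N in (D : Filter ℕ), ‖v N‖ ≤ C}
  zero_mem' := ⟨0, by simp⟩
  add_mem' := by
    rintro v w ⟨C, hC⟩ ⟨C', hC'⟩
    refine ⟨C + C', ?_⟩
    filter_upwards [hC, hC'] with N h h'
    exact (norm_add_le _ _).trans (add_le_add h h')
  smul_mem' := by
    rintro c v ⟨C, hC⟩
    refine ⟨‖c‖ * C, ?_⟩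
    filter_upwards [hC] with N h
    rw [Pi.smul_apply, norm_smul]
    gcongr

/-- The space of finite sequences (before passing to classes). -/
def FinSeq : Type _ := finSub D E

instance : AddCommGroup (FinSeq D E) := inferInstanceAs (AddCommGroup (finSub D E))
instance : Module ℂ (FinSeq D E) := inferInstanceAs (Module ℂ (finSub D E))

variable {D E}

/-- The `N`-th entry of a finite sequence. -/
def FinSeq.entry (v : FinSeq D E) (N : ℕ) : E N := v.1 N

/-- Build a finite sequence. -/
def FinSeq.of (v : ∀ N, E N) (h : ∃ C : ℝ, ∀ᶠ N in (D : Filter ℕ), ‖v N‖ ≤ C) : FinSeq D E :=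
  ⟨v, h⟩

@[simp] theorem FinSeq.entry_of (v : ∀ N, E N) (h) (N : ℕ) :
    (FinSeq.of (D := D) v h).entry N = v N := rfl
@[simp] theorem FinSeq.entry_add (v w : FinSeq D E) (N : ℕ) :
    (v + w).entry N = v.entry N + w.entry N := rfl
@[simp] theorem FinSeq.entry_smul (c : ℂ) (v : FinSeq D E) (N : ℕ) :
    (c • v).entry N = c • v.entry N := rfl
@[simp] theorem FinSeq.entry_sub (v w : FinSeq D E) (N : ℕ) :
    (v - w).entry N = v.entry N - w.entry N := rfl
@[simp] theorem FinSeq.entry_zero (N : ℕ) : (0 : FinSeq D E).entry N = 0 := rfl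

theorem FinSeq.ext {v w : FinSeq D E} (h : ∀ N, v.entry N = w.entry N) : v = w :=
  Subtype.ext (funext h)

theorem FinSeq.bdd (v : FinSeq D E) : ∃ C : ℝ, ∀ᶠ N in (D : Filter ℕ), ‖v.entry N‖ ≤ C := v.2

theorem FinSeq.isFin_inner (v w : FinSeq D E) :
    IsFin D (fun N => inner ℂ (v.entry N) (w.entry N)) := by
  obtain ⟨C, hC⟩ := v.bdd
  obtain ⟨C', hC'⟩ := w.bdd
  refine ⟨C * C', ?_⟩
  filter_upwards [hC, hC'] with N h h'
  exact (norm_inner_le_norm _ _).trans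
    (mul_le_mul h h' (norm_nonneg _) ((norm_nonneg _).trans h))

variable (D E)

/-- The pairing of finite sequences: the complex number infinitely close to
`(⟨v_N | w_N⟩)_N / D`. -/
@[reducible] def core : PreInnerProductSpace.Core ℂ (FinSeq D E) where
  inner v w := ulim D (fun N => inner ℂ (v.entry N) (w.entry N))
  conj_inner_symm v w := by
    have h := (Complex.continuous_conj.tendsto _).comp (tendsto_ulim (w.isFin_inner v))
    refine (ulim_eq ?_).symm
    refine h.congr fun N => ?_
    simp
  re_inner_nonneg v := by
    have h := (Complex.continuous_re.tendsto _).comp (tendsto_ulim (v.isFin_inner v))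
    refine ge_of_tendsto' h fun N => ?_
    exact inner_self_nonneg (𝕜 := ℂ)
  add_left u v w := by
    refine ulim_eq ?_
    refine ((tendsto_ulim (u.isFin_inner w)).add (tendsto_ulim (v.isFin_inner w))).congr fun N => ?_
    simp
  smul_left u v c := by
    refine ulim_eq ?_
    refine ((tendsto_ulim (u.isFin_inner v)).const_mul (conj c)).congr fun N => ?_
    simp [mul_comm]

instance : SeminormedAddCommGroup (FinSeq D E) :=
  @InnerProductSpace.Core.toSeminormedAddCommGroup ℂ _ _ _ _ (core D E)

instance : InnerProductSpace ℂ (FinSeq D E) := InnerProductSpace.ofCore (core D E)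

/-- The metric ultraproduct: finite sequences modulo infinitely small distance. -/
abbrev MUltra : Type _ := SeparationQuotient (FinSeq D E)

variable {D E}

theorem FinSeq.inner_def (v w : FinSeq D E) :
    inner ℂ v w = ulim D (fun N => inner ℂ (v.entry N) (w.entry N)) := rfl

theorem FinSeq.tendsto_norm (v : FinSeq D E) :
    Tendsto (fun N => ‖v.entry N‖) D (𝓝 ‖v‖) := by
  have h := (Complex.continuous_re.tendsto _).comp (tendsto_ulim (v.isFin_inner v))
  have h2 := (Real.continuous_sqrt.tendsto _).comp h
  have e : ‖v‖ = √(ulim D (fun N => inner ℂ (v.entry N) (v.entry N))).re := by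
    rw [norm_eq_sqrt_re_inner (𝕜 := ℂ) v]; rfl
  rw [e]
  refine h2.congr fun N => ?_
  simp only [Function.comp]
  rw [norm_eq_sqrt_re_inner (𝕜 := ℂ) (v.entry N)]; rfl

theorem FinSeq.norm_le (v : FinSeq D E) {C : ℝ} (h : ∀ᶠ N in (D : Filter ℕ), ‖v.entry N‖ ≤ C) :
    ‖v‖ ≤ C := le_of_tendsto v.tendsto_norm h

/-- The class in the metric ultraproduct of a finite sequence. -/
def mk : FinSeq D E →L[ℂ] MUltra D E := SeparationQuotient.mkCLM ℂ (FinSeq D E)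

theorem norm_mk (v : FinSeq D E) : ‖mk v‖ = ‖v‖ := SeparationQuotient.norm_mk v

instance [∀ N, CompleteSpace (E N)] : CompleteSpace (MUltra D E) := by
  classical
  refine NormedAddCommGroup.completeSpace_of_summable_imp_tendsto fun f hf => ?_
  choose g hg using fun j => SeparationQuotient.surjective_mk (f j)
  have hg' : ∀ j, ‖g j‖ = ‖f j‖ := fun j => by rw [← hg j]; rfl
  set b : ℕ → ℝ := fun j => ‖f j‖ + (1 / 2) ^ j with hb
  have hbs : Summable b := hf.add summable_geometric_two
  set e : ℕ → ∀ N, E N := fun j N => if ‖(g j).entry N‖ ≤ b j then (g j).entry N else 0 with he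
  have heb : ∀ j N, ‖e j N‖ ≤ b j := by
    intro j N
    simp only [he]
    split_ifs with h
    · exact h
    · simp only [norm_zero, hb]; positivity
  have hes : ∀ N, Summable fun j => e j N := fun N =>
    Summable.of_norm_bounded hbs fun j => heb j N
  have heq : ∀ j, ∀ᶠ N in (D : Filter ℕ), e j N = (g j).entry N := by
    intro j
    have hlt : ‖g j‖ < b j := by
      rw [hg' j]; simp only [hb]; linarith [show (0 : ℝ) < (1 / 2) ^ j by positivity]
    filter_upwards [(g j).tendsto_norm.eventually_lt_const hlt] with N hN
    simp [he, hN.le]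
  let y : FinSeq D E := FinSeq.of (fun N => ∑' j, e j N) ⟨∑' j, b j,
    Eventually.of_forall fun N => tsum_of_norm_bounded hbs.hasSum fun j => heb j N⟩
  refine ⟨mk y, ?_⟩
  have hentry : ∀ (k N : ℕ), (∑ j ∈ Finset.range k, g j).entry N
      = ∑ j ∈ Finset.range k, (g j).entry N := by
    intro k N
    induction k with
    | zero => simp
    | succ k ih => rw [Finset.sum_range_succ, Finset.sum_range_succ, FinSeq.entry_add, ih]
  have hbound : ∀ k, ‖(∑ j ∈ Finset.range k, f j) - mk y‖ ≤ ∑' j, b (j + k) := by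
    intro k
    have e1 : (∑ j ∈ Finset.range k, f j) - mk y = mk ((∑ j ∈ Finset.range k, g j) - y) := by
      rw [map_sub, map_sum]
      congr 1
      exact Finset.sum_congr rfl fun j _ => (hg j).symm
    rw [e1, norm_mk]
    refine FinSeq.norm_le _ ?_
    have hall : ∀ᶠ N in (D : Filter ℕ), ∀ j ∈ Finset.range k, e j N = (g j).entry N :=
      (Finset.eventually_all (Finset.range k)).2 fun j _ => heq j
    filter_upwards [hall] with N hN
    rw [FinSeq.entry_sub, hentry, ← Finset.sum_congr rfl hN]
    have : (y.entry N) = ∑ j ∈ Finset.range k, e j N + ∑' j, e (j + k) N :=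
      ((hes N).sum_add_tsum_nat_add k).symm
    rw [this, sub_add_cancel_left, norm_neg]
    exact tsum_of_norm_bounded ((summable_nat_add_iff k).2 hbs).hasSum fun j => heb (j + k) N
  rw [tendsto_iff_norm_sub_tendsto_zero]
  exact squeeze_zero (fun _ => norm_nonneg _) hbound (tendsto_sum_nat_add b)

/-- The operator on finite sequences induced by a uniformly bounded sequence of operators. -/
def seqMap (T : ∀ N, E N →ₗ[ℂ] E N) (C : ℝ) (hT : ∀ N v, ‖T N v‖ ≤ C * ‖v‖) :
    FinSeq D E →L[ℂ] FinSeq D E :=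
  LinearMap.mkContinuous
    { toFun := fun v => FinSeq.of (fun N => T N (v.entry N)) (by
        obtain ⟨B, hB⟩ := v.bdd
        refine ⟨|C| * B, ?_⟩
        filter_upwards [hB] with N hN
        refine (hT N _).trans ?_
        exact (mul_le_mul_of_nonneg_right (le_abs_self C) (norm_nonneg _)).trans
          (mul_le_mul_of_nonneg_left hN (abs_nonneg C)))
      map_add' := fun v w => FinSeq.ext fun N => by simp
      map_smul' := fun c v => FinSeq.ext fun N => by simp }
    C (fun v => le_of_tendsto_of_tendsto' (FinSeq.tendsto_norm _)
      (v.tendsto_norm.const_mul C) fun N => hT N _)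

/-- The metric ultraproduct of a uniformly bounded sequence of operators:
the class of `(v_N)` is sent to the class of `(T_N v_N)`. -/
def ultraMap (T : ∀ N, E N →ₗ[ℂ] E N) (C : ℝ) (hT : ∀ N v, ‖T N v‖ ≤ C * ‖v‖) :
    MUltra D E →L[ℂ] MUltra D E :=
  SeparationQuotient.liftCLM (mk ∘L seqMap T C hT) fun _ _ h =>
    (SeparationQuotient.mk_eq_mk.2 (h.map (seqMap T C hT).continuous))

end MetricUltra

/-! ### Finite dimensional approximations of a scaled unitary operator -/

namespace SpectralUltra

open MetricUltra

/-- `P(B, C)` for a polynomial `P` in two variables: the linear map with `XⁱYʲ ↦ Bⁱ Cʲ`. -/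
def polyOp {R : Type*} [Ring R] [Algebra ℂ R] (B C : R) : MvPolynomial (Fin 2) ℂ →ₗ[ℂ] R :=
  (MvPolynomial.basisMonomials (Fin 2) ℂ).constr ℂ fun m => B ^ m 0 * C ^ m 1

/-- `f_P(z) = P(z, z̄)`. -/
def polyFun (P : MvPolynomial (Fin 2) ℂ) (z : ℂ) : ℂ := MvPolynomial.eval ![z, conj z] P

theorem continuous_polyFun (P : MvPolynomial (Fin 2) ℂ) : Continuous (polyFun P) := by
  refine (MvPolynomial.continuous_eval P).comp (continuous_pi fun i => ?_)
  fin_cases i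
  · exact continuous_id
  · exact Complex.continuous_conj

variable {H : Type*} [NormedAddCommGroup H] [InnerProductSpace ℂ H] [CompleteSpace H]

/-- `P(A, A*)(φ)`, as a linear function of the polynomial `P`. -/
def polyVec (A : H →L[ℂ] H) (φ : H) : MvPolynomial (Fin 2) ℂ →ₗ[ℂ] H :=
  (ContinuousLinearMap.apply ℂ H φ).toLinearMap ∘ₗ polyOp A (ContinuousLinearMap.adjoint A)

/-- `φ` is cyclic: the vectors `P(A, A*)(φ)` are dense in the space. -/
def IsCyclicVec (A : H →L[ℂ] H) (φ : H) : Prop := Dense (Set.range (polyVec A φ))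

/-- `Aⁱ (A*)ʲ φ`. -/
def gen (A : H →L[ℂ] H) (φ : H) (i j : ℕ) : H := (A ^ i * (ContinuousLinearMap.adjoint A) ^ j) φ

/-- `H_N`. -/
def HN (A : H →L[ℂ] H) (φ : H) (N : ℕ) : Submodule ℂ H :=
  Submodule.span ℂ {v | ∃ i j, i ≤ N ∧ j ≤ N ∧ v = gen A φ i j}

/-- `H_N⁻`. -/
def HNminus (A : H →L[ℂ] H) (φ : H) (N : ℕ) : Submodule ℂ H :=
  Submodule.span ℂ {v | ∃ i j, i < N ∧ j ≤ N ∧ v = gen A φ i j}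

/-- `H_N⁺`. -/
def HNplus (A : H →L[ℂ] H) (φ : H) (N : ℕ) : Submodule ℂ H :=
  Submodule.span ℂ {v | ∃ i j, 0 < i ∧ i ≤ N ∧ j ≤ N ∧ v = gen A φ i j}

/-- `W⁻`, the orthogonal complement of `H_N⁻` in `H_N`. -/
def Wminus (A : H →L[ℂ] H) (φ : H) (N : ℕ) : Submodule ℂ H := (HNminus A φ N)ᗮ ⊓ HN A φ N

/-- `W⁺`, the orthogonal complement of `H_N⁺` in `H_N`. -/
def Wplus (A : H →L[ℂ] H) (φ : H) (N : ℕ) : Submodule ℂ H := (HNplus A φ N)ᗮ ⊓ HN A φ N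

theorem HNminus_le (A : H →L[ℂ] H) (φ : H) (N : ℕ) : HNminus A φ N ≤ HN A φ N := by
  refine Submodule.span_mono ?_
  rintro v ⟨i, j, hi, hj, rfl⟩
  exact ⟨i, j, hi.le, hj, rfl⟩

instance (A : H →L[ℂ] H) (φ : H) (N : ℕ) : FiniteDimensional ℂ (HN A φ N) := by
  refine FiniteDimensional.span_of_finite ℂ (Set.Finite.subset
    (((Set.finite_Iic N).prod (Set.finite_Iic N)).image fun p => gen A φ p.1 p.2) ?_)
  rintro v ⟨i, j, hi, hj, rfl⟩
  exact ⟨(i, j), ⟨hi, hj⟩, rfl⟩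

instance (A : H →L[ℂ] H) (φ : H) (N : ℕ) : FiniteDimensional ℂ (HNminus A φ N) :=
  Submodule.finiteDimensional_of_le (HNminus_le A φ N)

instance (A : H →L[ℂ] H) (φ : H) (N : ℕ) : FiniteDimensional ℂ (Wminus A φ N) :=
  Submodule.finiteDimensional_of_le (inf_le_right : _ ≤ HN A φ N)

instance (A : H →L[ℂ] H) (φ : H) (N : ℕ) : CompleteSpace (HN A φ N) :=
  FiniteDimensional.complete ℂ _

theorem map_mem_HN (A : H →L[ℂ] H) (φ : H) (N : ℕ) {v : H} (hv : v ∈ HNminus A φ N) :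
    A v ∈ HN A φ N := by
  have : HNminus A φ N ≤ (HN A φ N).comap A.toLinearMap := by
    refine Submodule.span_le.2 ?_
    rintro v ⟨i, j, hi, hj, rfl⟩
    refine Submodule.subset_span ⟨i + 1, j, hi, hj, ?_⟩
    simp [gen, pow_succ']
  exact this hv

/-- The operator `A_N` on `H_N`: it is `A` on `H_N⁻` and `√r · V` on `W⁻`. -/
def AN (A : H →L[ℂ] H) (φ : H) (r : ℝ) (N : ℕ) (V : Wminus A φ N ≃ₗᵢ[ℂ] Wplus A φ N) :
    HN A φ N →ₗ[ℂ] HN A φ N :=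
  LinearMap.codRestrict (HN A φ N)
    ((A.toLinearMap ∘ₗ (HNminus A φ N).subtype ∘ₗ (HNminus A φ N).orthogonalProjectionOnto.toLinearMap
      + ((√r : ℝ) : ℂ) • ((Wplus A φ N).subtype ∘ₗ V.toLinearEquiv.toLinearMap ∘ₗ
        (Wminus A φ N).orthogonalProjectionOnto.toLinearMap)) ∘ₗ (HN A φ N).subtype)
    (fun _ => add_mem (map_mem_HN A φ N (Subtype.mem _))
      (Submodule.smul_mem _ _ (Subtype.mem (V _)).2))

theorem norm_AN_le (A : H →L[ℂ] H) (φ : H) (r : ℝ) (N : ℕ)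
    (V : Wminus A φ N ≃ₗᵢ[ℂ] Wplus A φ N) (v : HN A φ N) :
    ‖AN A φ r N V v‖ ≤ (‖A‖ + √r) * ‖v‖ := by
  have h : ((AN A φ r N V v : HN A φ N) : H) = A ((HNminus A φ N).orthogonalProjectionOnto (v : H) : H)
      + ((√r : ℝ) : ℂ) • ((V ((Wminus A φ N).orthogonalProjectionOnto (v : H)) : Wplus A φ N) : H) := rfl
  change ‖((AN A φ r N V v : HN A φ N) : H)‖ ≤ _
  rw [h, add_mul]
  refine (norm_add_le _ _).trans (add_le_add ?_ ?_)
  · refine (A.le_opNorm _).trans (mul_le_mul_of_nonneg_left ?_ (norm_nonneg _))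
    exact Submodule.norm_orthogonalProjectionOnto_apply_le _ _
  · rw [norm_smul, Complex.norm_real, Real.norm_of_nonneg (Real.sqrt_nonneg _)]
    refine mul_le_mul_of_nonneg_left ?_ (Real.sqrt_nonneg _)
    change ‖V _‖ ≤ _
    rw [V.norm_map]
    exact Submodule.norm_orthogonalProjectionOnto_apply_le _ _

theorem mem_HN (A : H →L[ℂ] H) (φ : H) (N : ℕ) : φ ∈ HN A φ N :=
  Submodule.subset_span ⟨0, 0, Nat.zero_le _, Nat.zero_le _, by simp [gen]⟩

/-- The choices made in the construction of the approximations: for each `N` a unitary operator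
`V N` from `W⁻` onto `W⁺`, and an orthonormal basis of `H_N` that consists of eigenvectors
`u N n` of `A_N`, with eigenvalues `lam N n`, and in which the coordinates of `φ` are
non-negative reals. -/
structure Approx (A : H →L[ℂ] H) (φ : H) (r : ℝ) where
  V : ∀ N, Wminus A φ N ≃ₗᵢ[ℂ] Wplus A φ N
  u : ∀ N, OrthonormalBasis (Fin (Module.finrank ℂ (HN A φ N))) ℂ (HN A φ N)
  lam : ∀ N, Fin (Module.finrank ℂ (HN A φ N)) → ℂ
  eigen : ∀ N n, AN A φ r N (V N) (u N n) = lam N n • u N n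
  coord_nonneg : ∀ N n, ∃ x : ℝ, 0 ≤ x ∧ inner ℂ ((u N n : HN A φ N) : H) φ = (x : ℂ)

namespace Approx

variable {A : H →L[ℂ] H} {φ : H} {r : ℝ} (a : Approx A φ r)

/-- The operator `A_N`. -/
def op (N : ℕ) : HN A φ N →ₗ[ℂ] HN A φ N := AN A φ r N (a.V N)

/-- The non-negative real `ξ_N(n) = ⟨u_N(n) | φ⟩`. -/
def xi (N : ℕ) (n : Fin (Module.finrank ℂ (HN A φ N))) : ℝ :=
  (inner ℂ ((a.u N n : HN A φ N) : H) φ).re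

/-- `F_N(f) = ∑ₙ ξ_N(n) f(λ_N(n)) u_N(n)`. -/
def FN (f : ℂ → ℂ) (N : ℕ) : HN A φ N := ∑ n, ((a.xi N n : ℂ) * f (a.lam N n)) • a.u N n

theorem norm_lam_le (N : ℕ) (n) : ‖a.lam N n‖ ≤ ‖A‖ + √r := by
  have h := norm_AN_le A φ r N (a.V N) (a.u N n)
  rw [a.eigen, norm_smul] at h
  simpa using h

theorem FN_bdd {f : ℂ → ℂ} (hf : Continuous f) : ∃ C : ℝ, ∀ N, ‖a.FN f N‖ ≤ C := by
  obtain ⟨B, hB⟩ := (isCompact_closedBall (0 : ℂ) (‖A‖ + √r)).exists_bound_of_continuousOn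
    hf.continuousOn
  have hfB : ∀ N n, ‖f (a.lam N n)‖ ≤ |B| := fun N n =>
    (hB _ (by simpa using a.norm_lam_le N n)).trans (le_abs_self B)
  refine ⟨|B| * ‖φ‖, fun N => ?_⟩
  refine abs_le_of_sq_le_sq' ?_ (by positivity) |>.2
  let φN : HN A φ N := ⟨φ, mem_HN A φ N⟩
  have h1 : ‖a.FN f N‖ ^ 2 = ∑ n, ‖(a.xi N n : ℂ) * f (a.lam N n)‖ ^ 2 := by
    rw [← (a.u N).sum_sq_norm_inner_right]
    refine Finset.sum_congr rfl fun n _ => ?_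
    rw [FN, (a.u N).orthonormal.inner_right_fintype]
  have h2 : ‖φN‖ ^ 2 = ∑ n, ‖inner ℂ (a.u N n) φN‖ ^ 2 := by
    rw [← (a.u N).sum_sq_norm_inner_right]
  have h3 : ‖φN‖ = ‖φ‖ := rfl
  rw [h1, mul_pow, ← h3, h2, Finset.mul_sum]
  refine Finset.sum_le_sum fun n _ => ?_
  rw [norm_mul, mul_pow, mul_comm]
  refine mul_le_mul (pow_le_pow_left₀ (norm_nonneg _) (hfB N n) 2)
    (pow_le_pow_left₀ (norm_nonneg _) ?_ 2) (by positivity) (by positivity)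
  rw [Complex.norm_real, Real.norm_eq_abs]
  exact Complex.abs_re_le_norm _

variable (D : Ultrafilter ℕ)

variable (A φ) in
/-- `H^m`, the metric ultraproduct of the spaces `H_N`. -/
abbrev Hm : Type _ := MUltra D fun N => HN A φ N

/-- `A^m`, the metric ultraproduct of the operators `A_N`. -/
def Am : Hm A φ D →L[ℂ] Hm A φ D :=
  ultraMap a.op (‖A‖ + √r) fun N v => norm_AN_le A φ r N (a.V N) v

/-- `(F_N(f_P))_N / D / ∼`, as a linear function of `P`. -/
def FmPoly : MvPolynomial (Fin 2) ℂ →ₗ[ℂ] Hm A φ D where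
  toFun P := MetricUltra.mk (FinSeq.of (a.FN (polyFun P))
    ((a.FN_bdd (continuous_polyFun P)).imp fun _ h => Eventually.of_forall h))
  map_add' P Q := by
    rw [← map_add]
    congr 1
    refine FinSeq.ext fun N => ?_
    simp [FN, polyFun, mul_add, add_smul, Finset.sum_add_distrib]
  map_smul' c P := by
    rw [RingHom.id_apply, ← map_smul]
    congr 1
    refine FinSeq.ext fun N => ?_
    simp only [FN, polyFun, FinSeq.entry_of, FinSeq.entry_smul, Finset.smul_sum, smul_smul,
      MvPolynomial.smul_eval]
    exact Finset.sum_congr rfl fun n _ => by rw [mul_left_comm]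

variable (A φ) in
/-- `(P(A, A*)(φ))_N / D / ∼`, as a linear function of `P`. The vector `P(A, A*)(φ)` lies in `H_N`
for all large `N`, and is then its own orthogonal projection to `H_N`; the finitely many other
entries of the sequence do not matter. -/
def GmPoly : MvPolynomial (Fin 2) ℂ →ₗ[ℂ] Hm A φ D where
  toFun P := MetricUltra.mk (FinSeq.of (fun N => (HN A φ N).orthogonalProjectionOnto (polyVec A φ P))
    ⟨‖polyVec A φ P‖, Eventually.of_forall fun _ =>
      Submodule.norm_orthogonalProjectionOnto_apply_le _ _⟩)
  map_add' P Q := by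
    rw [← map_add]
    congr 1
    exact FinSeq.ext fun N => by simp
  map_smul' c P := by
    rw [RingHom.id_apply, ← map_smul]
    congr 1
    exact FinSeq.ext fun N => by simp

variable (A φ) in
/-- `G^m : H → H^m`, the continuous linear map determined by
`P(A, A*)(φ) ↦ (P(A, A*)(φ))_N / D / ∼`. -/
def Gm : H →L[ℂ] Hm A φ D := (GmPoly A φ D).extendOfNorm (polyVec A φ)

variable (A φ) in
/-- `H^Im`, the range of `G^m`. -/
def HIm : Submodule ℂ (Hm A φ D) := LinearMap.range (Gm A φ D).toLinearMap

/-! ### The measure -/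

/-- `μ_N(X) = ∑ ξ_N(n)²` over the `n` with `λ_N(n) ∈ X`. -/
def muN (N : ℕ) (X : Set ℂ) : ℝ := ∑ n, X.indicator (fun _ => a.xi N n ^ 2) (a.lam N n)

/-- The naive measure: the ultralimit of the numbers `μ_N(X)`. -/
def muNaive (X : Set ℂ) : ℝ := limUnder (D : Filter ℕ) fun N => a.muN N X

end Approx

/-- The square `S`. -/
def square (M : ℕ) : Set ℂ := Set.Icc (-(M : ℝ)) M ×ℂ Set.Icc (-(M : ℝ)) M

instance (M : ℕ) : CompactSpace (square M) :=
  isCompact_iff_compactSpace.1 (isCompact_Icc.reProdIm isCompact_Icc)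

namespace Approx

variable {A : H →L[ℂ] H} {φ : H} {r : ℝ} (a : Approx A φ r) (D : Ultrafilter ℕ) (M : ℕ)

/-- The real `t` is nice: narrow vertical and horizontal strips in `S` around the lines
`Re z = t` and `Im z = t` have small naive measure. -/
def IsNice (t : ℝ) : Prop :=
  ∀ δ > 0, ∃ ε > 0, a.muNaive D {z | z ∈ square M ∧ |z.re - t| < ε} < δ ∧
    a.muNaive D {z | z ∈ square M ∧ |z.im - t| < ε} < δ

/-- A choice of a countable dense set of nice reals in `[-M, M]` that contains `-M` and `M`. -/
structure NiceGrid where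
  carrier : Set ℝ
  subset : carrier ⊆ Set.Icc (-(M : ℝ)) M
  countable : carrier.Countable
  dense : Set.Icc (-(M : ℝ)) M ⊆ closure carrier
  nice : ∀ t ∈ carrier, a.IsNice D M t
  left_mem : -(M : ℝ) ∈ carrier
  right_mem : (M : ℝ) ∈ carrier

variable {a D M}

namespace NiceGrid

variable (NI : a.NiceGrid D M)

/-- `Sq*`: the open rectangles with edges in the chosen set of nice reals. -/
def IsSq (Y : Set ℂ) : Prop :=
  ∃ r₀ ∈ NI.carrier, ∃ r₁ ∈ NI.carrier, ∃ r₂ ∈ NI.carrier, ∃ r₃ ∈ NI.carrier,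
    Y = {z | z ∈ square M ∧ r₀ < z.re ∧ z.re < r₁ ∧ r₂ < z.im ∧ z.im < r₃}

theorem isSq_empty : NI.IsSq ∅ := by
  refine ⟨M, NI.right_mem, M, NI.right_mem, M, NI.right_mem, M, NI.right_mem, ?_⟩
  ext z
  simp only [Set.mem_empty_iff_false, Set.mem_ofPred_eq, false_iff]
  rintro ⟨-, h1, h2, -⟩
  exact absurd h1 h2.not_gt

theorem muNaive_empty : ENNReal.ofReal (a.muNaive D ∅) = 0 := by
  have : a.muNaive D ∅ = 0 := by
    refine Tendsto.limUnder_eq ?_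
    simp [muN]
  simp [this]

/-- The outer measure `μ*` on subsets of `ℂ`: for `Y ⊆ Int S`, it is the infimum of
`∑ᵢ μⁿ(Xᵢ)` over the countable covers of `Y` by sets `Xᵢ ∈ Sq*`, and `μ*(X) = μ*(X ∩ Int S)`
in general. -/
def outer : OuterMeasure ℂ :=
  OuterMeasure.restrict (interior (square M))
    (inducedOuterMeasure (fun Y (_ : NI.IsSq Y) => ENNReal.ofReal (a.muNaive D Y))
      NI.isSq_empty muNaive_empty)

theorem outer_lt_top (X : Set ℂ) : NI.outer X < ∞ := by
  have hsq : NI.IsSq (interior (square M)) := by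
    refine ⟨-M, NI.left_mem, M, NI.right_mem, -M, NI.left_mem, M, NI.right_mem, ?_⟩
    rw [square, Complex.interior_reProdIm, interior_Icc]
    ext z
    simp only [Complex.mem_reProdIm, Set.mem_Ioo, Set.mem_Icc, Set.mem_ofPred_eq]
    constructor
    · rintro ⟨⟨h1, h2⟩, h3, h4⟩
      exact ⟨⟨⟨h1.le, h2.le⟩, h3.le, h4.le⟩, h1, h2, h3, h4⟩
    · rintro ⟨-, h1, h2, h3, h4⟩
      exact ⟨⟨h1, h2⟩, h3, h4⟩
  rw [outer, OuterMeasure.restrict_apply]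
  refine lt_of_le_of_lt (measure_mono Set.inter_subset_right) ?_
  refine lt_of_le_of_lt (le_inducedOuterMeasure.1 le_rfl _ hsq) ENNReal.ofReal_lt_top

open scoped Classical in
/-- The measure on the Borel subsets of `ℂ` obtained by restricting `μ*` to them (they are all
Carathéodory measurable for `μ*`; the other branch does not occur). -/
def measureC : Measure ℂ :=
  if h : Complex.measurableSpace ≤ NI.outer.caratheodory then NI.outer.toMeasure h
  else 0

instance : IsFiniteMeasure NI.measureC := by
  refine ⟨?_⟩
  rw [measureC]
  split_ifs with h
  · rw [toMeasure_apply _ _ MeasurableSet.univ]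
    exact NI.outer_lt_top _
  · simp

/-- The Borel measure `μ` on `S`. -/
def measure : Measure (square M) := NI.measureC.comap Subtype.val

instance : IsFiniteMeasure NI.measure := by
  have hS : MeasurableSet (square M) :=
    (isCompact_Icc.reProdIm isCompact_Icc).isClosed.measurableSet
  refine ⟨?_⟩
  rw [measure, comap_subtype_coe_apply hS]
  exact measure_lt_top _ _

/-- `L₂(S, μ)`. -/
abbrev L2 : Type := Lp ℂ 2 NI.measure

/-- The class `[f_P]₂` in `L₂(S, μ)`, as a linear function of `P`. -/
def polyL2 : MvPolynomial (Fin 2) ℂ →ₗ[ℂ] NI.L2 where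
  toFun P := ContinuousMap.toLp 2 NI.measure ℂ
    (⟨fun z => polyFun P z, (continuous_polyFun P).comp continuous_subtype_val⟩ : C(square M, ℂ))
  map_add' P Q := by
    rw [← map_add]
    congr 1
    ext z
    simp [polyFun]
  map_smul' c P := by
    rw [RingHom.id_apply, ← map_smul]
    congr 1
    ext z
    simp [polyFun]

/-- `A_D`, the continuous extension to `L₂(S, μ)` of `f_P ↦ f_{X P}`. -/
def AD : NI.L2 →L[ℂ] NI.L2 :=
  (NI.polyL2 ∘ₗ LinearMap.mulLeft ℂ (MvPolynomial.X 0)).extendOfNorm NI.polyL2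

/-- `F^m`, the continuous extension to `L₂(S, μ)` of `f_P ↦ (F_N(f_P))_N / D / ∼`. -/
def Fm : NI.L2 →L[ℂ] Hm A φ D := (a.FmPoly D).extendOfNorm NI.polyL2

end NiceGrid

end Approx

end SpectralUltra

end

/-! Both $F^m$ and $G^m$ are isometric on polynomials and take the same values there, and this
determines everything else.

The values agree because the truncation is exact on monomials. Each $A_N$ is $\sqrt r$ times a
unitary and agrees with $A$ on $H_N^-$, and $A^*$ and $A_N^*$ are $r$ times the inverses of $A$ and
$A_N$. So $A_N^*$ moves $(A^*)^j\varphi$ to $(A^*)^{j+1}\varphi$ for $j<N$, and the spectral sum for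
$z^i\bar z^j$ is $A^i(A^*)^j\varphi$ whenever $i,j\le N$ (`coe_FN_pow_mul_conj_pow`). As $D$ is
nonprincipal, `FmPoly` and `GmPoly` coincide.

The norm of `GmPoly` at $P$ is $\|P(A,A^*)\varphi\|$. The squared norm of `FmPoly` is
$\lim_D\int|f_P|^2\,d\mu_N$, so it must be shown that $\mu$ integrates $|f_P|^2$ to this limit. The
$\mu_N$ are probability measures on a fixed disc, hence have a weak limit $\nu$ along $D$
(`exists_isWeakLimit`). The portmanteau inequality $\nu(U)\le\mu^n(U)$ for open $U$ gives
$\nu\le\mu$, and $\mu$ has mass at most 1 because $\mathrm{Int}(S)$ is itself in $Sq^*$; hence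
$\mu=\nu$ (`measureC_eq`). The same $\nu$ yields nice reals, since only countably many vertical or
horizontal lines carry mass.

Polynomials are dense in $L_2(S,\mu)$ by Stone–Weierstrass, and their images are dense in $H$ by
cyclicity. Both maps therefore extend to isometries with the same closed range, and multiplication
by $X$ carries the three operators into one another. -/

/-! ### Diagonalization of normal operators in finite dimension -/

theorem LinearMap.exists_orthonormalBasis_eigenvectors_of_commute_adjoint {E : Type*}
    [NormedAddCommGroup E] [InnerProductSpace ℂ E] [FiniteDimensional ℂ E] (T : E →ₗ[ℂ] E)
    (hT : Commute (LinearMap.adjoint T) T) :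
    ∃ (b : OrthonormalBasis (Fin (Module.finrank ℂ E)) ℂ E) (l : Fin (Module.finrank ℂ E) → ℂ),
      ∀ n, T (b n) = l n • b n := by
  classical
  -- $R$ and $J$ are twice the real part and twice the imaginary part of $T$, so $T=\frac12(R+iJ)$;
  -- normality makes them commute, and a joint eigenvector of both is an eigenvector of $T$.
  set R : E →ₗ[ℂ] E := LinearMap.adjoint T + T with hR
  set J : E →ₗ[ℂ] E := Complex.I • (LinearMap.adjoint T - T) with hJ
  have hRs : R.IsSymmetric := fun x y => by
    simp [hR, ← LinearMap.adjoint_inner_right, inner_add_left,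
      inner_add_right, add_comm]
  have hJs : J.IsSymmetric := fun x y => by
    simp only [hJ, LinearMap.smul_apply, LinearMap.sub_apply, inner_smul_left, inner_smul_right,
      inner_sub_left, inner_sub_right, LinearMap.adjoint_inner_left, LinearMap.adjoint_inner_right,
      Complex.conj_I]
    ring
  have hc : Commute R J := by
    refine Commute.smul_right ?_ _
    exact ((Commute.refl _).sub_right hT).add_left (hT.symm.sub_right (Commute.refl _))
  -- The joint eigenspaces are indexed by all of $\mathbb C\times\mathbb C$; discarding the zero
  -- ones leaves a finite index type, as the subordinate basis requires.
  have hint := (DirectSum.isInternal_ne_bot_iff).2 (hRs.directSum_isInternal_of_commute hJs hc)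
  have horth := (hRs.orthogonalFamily_eigenspace_inf_eigenspace hJs)
  have hfin : Finite {i : ℂ × ℂ // (Module.End.eigenspace R i.2 ⊓ Module.End.eigenspace J i.1) ≠ ⊥} :=
    WellFoundedGT.finite_ne_bot_of_iSupIndep horth.independent
  have : Fintype {i : ℂ × ℂ // (Module.End.eigenspace R i.2 ⊓ Module.End.eigenspace J i.1) ≠ ⊥} :=
    Fintype.ofFinite _
  have horth' := horth.comp (f := fun i : {i : ℂ × ℂ // (Module.End.eigenspace R i.2 ⊓
    Module.End.eigenspace J i.1) ≠ ⊥} => i.1) Subtype.val_injective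
  refine ⟨hint.subordinateOrthonormalBasis rfl horth', fun n =>
    let i := (hint.subordinateOrthonormalBasisIndex rfl n horth').1
    (1 / 2) * (i.2 + Complex.I * i.1), fun n => ?_⟩
  have h := hint.subordinateOrthonormalBasis_subordinate rfl n horth'
  obtain ⟨h1, h2⟩ := Submodule.mem_inf.1 h
  rw [Module.End.mem_eigenspace_iff] at h1 h2
  set b := hint.subordinateOrthonormalBasis rfl horth' n
  have hTb : T b = (1 / 2 : ℂ) • (R b + Complex.I • J b) := by
    simp only [hR, hJ, LinearMap.add_apply, LinearMap.smul_apply, LinearMap.sub_apply, smul_smul,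
      Complex.I_mul_I, smul_add, smul_sub]
    module
  rw [hTb, h1, h2]
  simp only [smul_smul, ← add_smul]

/-! ### The operators $A_N$: multiples of unitaries, existence of the choices -/

namespace SpectralUltra

open MetricUltra

variable {H : Type*} [NormedAddCommGroup H] [InnerProductSpace ℂ H] [CompleteSpace H]

theorem mul_adjoint_of_smul_unitary {A : H →L[ℂ] H}
    (hA : ∃ q : ℂ, q ≠ 0 ∧ ∃ U ∈ unitary (H →L[ℂ] H), A = q • U) :
    A * ContinuousLinearMap.adjoint A = ContinuousLinearMap.adjoint A * A := by
  obtain ⟨q, -, U, hU, rfl⟩ := hA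
  have h1 := Unitary.star_mul_self_of_mem hU
  have h2 := Unitary.mul_star_self_of_mem hU
  rw [← ContinuousLinearMap.star_eq_adjoint, star_smul, smul_mul_smul_comm, smul_mul_smul_comm,
    h1, h2, mul_comm]

section

variable {A : H →L[ℂ] H} {r : ℝ} (hAr : ContinuousLinearMap.adjoint A * A = (r : ℂ) • 1)
include hAr

theorem adjoint_apply_apply (v : H) : ContinuousLinearMap.adjoint A (A v) = (r : ℂ) • v :=
  DFunLike.congr_fun hAr v

theorem inner_map_map_eq (v w : H) : inner ℂ (A v) (A w) = (r : ℂ) * inner ℂ v w := by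
  rw [← ContinuousLinearMap.adjoint_inner_right, adjoint_apply_apply hAr, inner_smul_right]

theorem map_injective (hr : 0 < r) : Function.Injective A := by
  intro v w h
  have := congrArg (ContinuousLinearMap.adjoint A) h
  rw [adjoint_apply_apply hAr, adjoint_apply_apply hAr] at this
  exact smul_right_injective H (by exact_mod_cast hr.ne') this

end

variable (A : H →L[ℂ] H) (φ : H) (N : ℕ)

theorem map_HNminus : (HNminus A φ N).map A.toLinearMap = HNplus A φ N := by
  rw [HNminus, HNplus, Submodule.map_span]
  congr 1
  ext v
  constructor
  · rintro ⟨_, ⟨i, j, hi, hj, rfl⟩, rfl⟩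
    exact ⟨i + 1, j, i.succ_pos, hi, hj, by simp [gen, pow_succ']⟩
  · rintro ⟨i, j, hi, hiN, hj, rfl⟩
    obtain ⟨i, rfl⟩ := Nat.exists_eq_add_of_lt hi
    exact ⟨gen A φ i j, ⟨i, j, by omega, hj, rfl⟩, by simp [gen, pow_succ']⟩

theorem HNplus_le : HNplus A φ N ≤ HN A φ N := by
  refine Submodule.span_mono ?_
  rintro v ⟨i, j, -, hi, hj, rfl⟩
  exact ⟨i, j, hi, hj, rfl⟩

instance : FiniteDimensional ℂ (HNplus A φ N) :=
  Submodule.finiteDimensional_of_le (HNplus_le A φ N)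

instance : FiniteDimensional ℂ (Wplus A φ N) :=
  Submodule.finiteDimensional_of_le (inf_le_right : _ ≤ HN A φ N)

variable {A φ N}

theorem gen_mem_HN {i j : ℕ} (hi : i ≤ N) (hj : j ≤ N) : gen A φ i j ∈ HN A φ N :=
  Submodule.subset_span ⟨i, j, hi, hj, rfl⟩

theorem gen_mem_HNminus {i j : ℕ} (hi : i < N) (hj : j ≤ N) : gen A φ i j ∈ HNminus A φ N :=
  Submodule.subset_span ⟨i, j, hi, hj, rfl⟩

theorem apply_gen (i j : ℕ) : A (gen A φ i j) = gen A φ (i + 1) j := by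
  simp [gen, pow_succ']

/-- The injective $A$ maps $H_N^-$ onto $H_N^+$, so these have equal dimension and so do their
complements in $H_N$. This is what makes a unitary $V_N$ possible. -/
theorem finrank_Wminus_eq {r : ℝ} (hr : 0 < r)
    (hAr : ContinuousLinearMap.adjoint A * A = (r : ℂ) • 1) :
    Module.finrank ℂ (Wminus A φ N) = Module.finrank ℂ (Wplus A φ N) := by
  have h1 := Submodule.finrank_add_inf_finrank_orthogonal (HNminus_le A φ N)
  have h2 := Submodule.finrank_add_inf_finrank_orthogonal (HNplus_le A φ N)
  have h3 : Module.finrank ℂ (HNminus A φ N) = Module.finrank ℂ (HNplus A φ N) := by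
    rw [← map_HNminus]
    exact (LinearEquiv.finrank_eq
      (Submodule.equivMapOfInjective A.toLinearMap (map_injective hAr hr) _))
  rw [Wminus, Wplus]
  omega

/-- Orthogonal decompositions are unique, so the projections in `AN` can be replaced by any given
splitting of the vector. -/
theorem coe_AN_add {r : ℝ} (V : Wminus A φ N ≃ₗᵢ[ℂ] Wplus A φ N) {v : HN A φ N}
    {p : H} (hp : p ∈ HNminus A φ N) (w : Wminus A φ N) (hv : (v : H) = p + w) :
    (AN A φ r N V v : H) = A p + ((√r : ℝ) : ℂ) • (V w : H) := by
  have h : ((AN A φ r N V v : HN A φ N) : H) = A ((HNminus A φ N).orthogonalProjectionOnto (v : H) : H)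
      + ((√r : ℝ) : ℂ) • ((V ((Wminus A φ N).orthogonalProjectionOnto (v : H)) : Wplus A φ N) : H) := rfl
  have hw := (Submodule.mem_inf.1 w.2).1
  have h1 : ((HNminus A φ N).orthogonalProjectionOnto (v : H) : H) = p := by
    refine Submodule.eq_starProjection_of_mem_of_inner_eq_zero hp fun x hx => ?_
    rw [hv, add_sub_cancel_left]
    exact Submodule.inner_left_of_mem_orthogonal hx hw
  have h2 : (Wminus A φ N).orthogonalProjectionOnto (v : H) = w := by
    refine Subtype.ext ?_
    refine Submodule.eq_starProjection_of_mem_of_inner_eq_zero w.2 fun x hx => ?_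
    rw [hv, add_sub_cancel_right]
    exact Submodule.inner_right_of_mem_orthogonal hp (Submodule.mem_inf.1 hx).1
  rw [h, h1, h2]

theorem coe_AN_of_mem {r : ℝ} (V : Wminus A φ N ≃ₗᵢ[ℂ] Wplus A φ N) {v : HN A φ N}
    (hv : (v : H) ∈ HNminus A φ N) : (AN A φ r N V v : H) = A v := by
  rw [coe_AN_add V hv 0 (by simp)]
  simp

theorem exists_eq_add (v : HN A φ N) :
    ∃ p ∈ HNminus A φ N, ∃ w : Wminus A φ N, (v : H) = p + w := by
  refine ⟨(HNminus A φ N).starProjection v, Submodule.starProjection_apply_mem _ _,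
    ⟨v - (HNminus A φ N).starProjection v, Submodule.mem_inf.2
      ⟨Submodule.sub_starProjection_mem_orthogonal _, sub_mem v.2 (HNminus_le A φ N
        (Submodule.starProjection_apply_mem _ _))⟩⟩, ?_⟩
  simp

/-- $A$ sends $H_N^-$ into $H_N^+$ and $\sqrt r\,V$ sends $W_N^-$ into $W_N^+$. Each scales inner
products by $r$, and the cross terms vanish before and after. -/
theorem inner_AN_AN {r : ℝ} (hr : 0 < r)
    (hAr : ContinuousLinearMap.adjoint A * A = (r : ℂ) • 1)
    (V : Wminus A φ N ≃ₗᵢ[ℂ] Wplus A φ N) (v v' : HN A φ N) :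
    inner ℂ (AN A φ r N V v) (AN A φ r N V v') = (r : ℂ) * inner ℂ v v' := by
  obtain ⟨p, hp, w, hv⟩ := exists_eq_add v
  obtain ⟨p', hp', w', hv'⟩ := exists_eq_add v'
  rw [Submodule.coe_inner, Submodule.coe_inner, coe_AN_add V hp w hv, coe_AN_add V hp' w' hv',
    hv, hv']
  have hAp : ∀ p ∈ HNminus A φ N, A p ∈ HNplus A φ N := fun p hp => by
    rw [← map_HNminus]; exact ⟨p, hp, rfl⟩
  have e1 : inner ℂ (A p) (V w' : H) = 0 := Submodule.inner_right_of_mem_orthogonal (hAp p hp)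
    (Submodule.mem_inf.1 (V w').2).1
  have e2 : inner ℂ (V w : H) (A p') = 0 := Submodule.inner_left_of_mem_orthogonal (hAp p' hp')
    (Submodule.mem_inf.1 (V w).2).1
  have e3 : inner ℂ p (w' : H) = 0 := Submodule.inner_right_of_mem_orthogonal hp
    (Submodule.mem_inf.1 w'.2).1
  have e4 : inner ℂ (w : H) p' = 0 := Submodule.inner_left_of_mem_orthogonal hp'
    (Submodule.mem_inf.1 w.2).1
  have e5 : inner ℂ (V w : H) (V w' : H) = inner ℂ (w : H) (w' : H) := V.inner_map_map w w'
  have e6 : ((√r : ℝ) : ℂ) * ((√r : ℝ) : ℂ) = r := by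
    rw [← Complex.ofReal_mul, Real.mul_self_sqrt hr.le]
  simp only [inner_add_left, inner_add_right, inner_smul_left, inner_smul_right, e1, e2, e3, e4, e5,
    inner_map_map_eq hAr, Complex.conj_ofReal]
  linear_combination inner ℂ (w : H) (w' : H) * e6

theorem adjoint_AN_comp_AN {r : ℝ} (hr : 0 < r)
    (hAr : ContinuousLinearMap.adjoint A * A = (r : ℂ) • 1)
    (V : Wminus A φ N ≃ₗᵢ[ℂ] Wplus A φ N) :
    LinearMap.adjoint (AN A φ r N V) ∘ₗ AN A φ r N V = (r : ℂ) • LinearMap.id := by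
  refine LinearMap.ext fun v => ext_inner_left ℂ fun w => ?_
  rw [LinearMap.comp_apply, LinearMap.adjoint_inner_right, inner_AN_AN hr hAr, LinearMap.smul_apply,
    inner_smul_right, LinearMap.id_apply]

theorem AN_comp_adjoint_AN {r : ℝ} (hr : 0 < r)
    (hAr : ContinuousLinearMap.adjoint A * A = (r : ℂ) • 1)
    (V : Wminus A φ N ≃ₗᵢ[ℂ] Wplus A φ N) :
    AN A φ r N V ∘ₗ LinearMap.adjoint (AN A φ r N V) = (r : ℂ) • LinearMap.id := by
  have hr' : (r : ℂ) ≠ 0 := by exact_mod_cast hr.ne'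
  have h : ((r : ℂ)⁻¹ • LinearMap.adjoint (AN A φ r N V)) ∘ₗ AN A φ r N V = LinearMap.id := by
    rw [LinearMap.smul_comp, adjoint_AN_comp_AN hr hAr, smul_smul, inv_mul_cancel₀ hr', one_smul]
  -- In finite dimension a left inverse is a right inverse.
  have h2 := mul_eq_one_comm.1 h
  change _ ∘ₗ _ = LinearMap.id at h2
  rw [LinearMap.comp_smul] at h2
  rw [← h2, smul_smul, mul_inv_cancel₀ hr', one_smul]

/-- Supplies the phases by which the eigenvectors are rotated to make the coordinates of $\varphi$
non-negative. -/
theorem exists_unit_mul_eq_norm (z : ℂ) : ∃ c : ℂ, ‖c‖ = 1 ∧ conj c * z = (‖z‖ : ℂ) := by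
  by_cases hz : z = 0
  · exact ⟨1, by simp, by simp [hz]⟩
  · have hz' : (‖z‖ : ℂ) ≠ 0 := by simpa using hz
    refine ⟨z / ‖z‖, by simp [hz], ?_⟩
    rw [map_div₀, Complex.conj_ofReal, div_mul_eq_mul_div, mul_comm, Complex.mul_conj,
      Complex.normSq_eq_norm_sq]
    push_cast
    field_simp

theorem nonempty_approx {r : ℝ} (hr : 0 < r)
    (hAr : ContinuousLinearMap.adjoint A * A = (r : ℂ) • 1) : Nonempty (Approx A φ r) := by
  let V : ∀ N, Wminus A φ N ≃ₗᵢ[ℂ] Wplus A φ N := fun N =>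
    (stdOrthonormalBasis ℂ (Wminus A φ N)).equiv (stdOrthonormalBasis ℂ (Wplus A φ N))
      (finCongr (finrank_Wminus_eq hr hAr))
  have hcomm : ∀ N, Commute (LinearMap.adjoint (AN A φ r N (V N))) (AN A φ r N (V N)) := fun N =>
    (adjoint_AN_comp_AN hr hAr (V N)).trans (AN_comp_adjoint_AN hr hAr (V N)).symm
  choose b l hbl using fun N =>
    LinearMap.exists_orthonormalBasis_eigenvectors_of_commute_adjoint _ (hcomm N)
  choose c hc hcz using fun N n => exists_unit_mul_eq_norm (inner ℂ ((b N n : HN A φ N) : H) φ)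
  have horth : ∀ N, Orthonormal ℂ fun n => c N n • b N n := fun N => by
    constructor
    · intro n; simp [norm_smul, hc]
    · intro i j hij
      simp [inner_smul_left, inner_smul_right, (b N).orthonormal.2 hij]
  let u : ∀ N, OrthonormalBasis (Fin (Module.finrank ℂ (HN A φ N))) ℂ (HN A φ N) := fun N =>
    OrthonormalBasis.mk (horth N)
      ((horth N).linearIndependent.span_eq_top_of_card_eq_finrank' (by simp)).ge
  have hu : ∀ N n, u N n = c N n • b N n := fun N n => by simp [u]
  refine ⟨⟨V, u, l, fun N n => ?_, fun N n => ?_⟩⟩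
  · rw [hu, map_smul, hbl, smul_comm]
  · refine ⟨‖inner ℂ ((b N n : HN A φ N) : H) φ‖, norm_nonneg _, ?_⟩
    rw [hu, Submodule.coe_smul, inner_smul_left, hcz]

end SpectralUltra

/-! ### Exactness of the approximations on polynomials -/

namespace MetricUltra

variable {D : Ultrafilter ℕ} {E : ℕ → Type*}
  [∀ N, NormedAddCommGroup (E N)] [∀ N, InnerProductSpace ℂ (E N)]

theorem mk_eq_mk_of_eventually {v w : FinSeq D E}
    (h : ∀ᶠ N in (D : Filter ℕ), v.entry N = w.entry N) : mk v = mk w := by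
  rw [← sub_eq_zero, ← map_sub, ← norm_le_zero_iff, norm_mk]
  refine FinSeq.norm_le _ ?_
  filter_upwards [h] with N hN
  simp [hN]

theorem ultraMap_mk (T : ∀ N, E N →ₗ[ℂ] E N) (C : ℝ) (hT : ∀ N v, ‖T N v‖ ≤ C * ‖v‖)
    (v : FinSeq D E) : ultraMap T C hT (mk v) = mk (seqMap T C hT v) := rfl

end MetricUltra

namespace SpectralUltra

open MetricUltra

variable {H : Type*} [NormedAddCommGroup H] [InnerProductSpace ℂ H] [CompleteSpace H]
variable {A : H →L[ℂ] H} {φ : H}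

theorem polyVec_monomial (m : Fin 2 →₀ ℕ) (c : ℂ) :
    polyVec A φ (MvPolynomial.monomial m c) = c • gen A φ (m 0) (m 1) := by
  have h : polyVec A φ (MvPolynomial.monomial m 1) = gen A φ (m 0) (m 1) := by
    have := (MvPolynomial.basisMonomials (Fin 2) ℂ).constr_basis ℂ
      (fun m => A ^ m 0 * (ContinuousLinearMap.adjoint A) ^ m 1) m
    rw [MvPolynomial.coe_basisMonomials] at this
    exact DFunLike.congr_fun this φ
  rw [← h, ← map_smul, MvPolynomial.smul_monomial, smul_eq_mul, mul_one]

theorem polyFun_monomial (m : Fin 2 →₀ ℕ) (c : ℂ) (z : ℂ) :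
    polyFun (MvPolynomial.monomial m c) z = c * (z ^ m 0 * conj z ^ m 1) := by
  simp [polyFun, MvPolynomial.eval_monomial, Finsupp.prod_fintype]

theorem polyFun_X_mul (P : MvPolynomial (Fin 2) ℂ) (z : ℂ) :
    polyFun (MvPolynomial.X 0 * P) z = z * polyFun P z := by
  simp [polyFun]

theorem polyVec_X_mul (P : MvPolynomial (Fin 2) ℂ) :
    polyVec A φ (MvPolynomial.X 0 * P) = A (polyVec A φ P) := by
  induction P using MvPolynomial.induction_on' with
  | monomial m c =>
    rw [MvPolynomial.X, MvPolynomial.monomial_mul, polyVec_monomial, polyVec_monomial, map_smul,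
      apply_gen]
    simp [add_comm]
  | add p q hp hq => rw [mul_add, map_add, map_add, map_add, hp, hq]

theorem eventually_polyVec_mem (P : MvPolynomial (Fin 2) ℂ) :
    ∀ᶠ N in atTop, polyVec A φ P ∈ HN A φ N := by
  induction P using MvPolynomial.induction_on' with
  | monomial m c =>
    filter_upwards [eventually_ge_atTop (m 0), eventually_ge_atTop (m 1)] with N h0 h1
    rw [polyVec_monomial]
    exact Submodule.smul_mem _ _ (gen_mem_HN h0 h1)
  | add p q hp hq =>
    filter_upwards [hp, hq] with N h h'
    rw [map_add]
    exact add_mem h h'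

namespace Approx

variable {r : ℝ} (a : Approx A φ r)

/-- The coordinate is real, so the real part taken in `xi` loses nothing; hence $F_N(1)=\varphi$. -/
theorem inner_u (N : ℕ) (n) : inner ℂ (a.u N n) ⟨φ, mem_HN A φ N⟩ = (a.xi N n : ℂ) := by
  obtain ⟨x, -, hx⟩ := a.coord_nonneg N n
  change inner ℂ ((a.u N n : HN A φ N) : H) φ = _
  rw [xi, hx, Complex.ofReal_re]

theorem FN_one (N : ℕ) : a.FN (fun _ => 1) N = ⟨φ, mem_HN A φ N⟩ := by
  rw [← (a.u N).sum_repr' ⟨φ, mem_HN A φ N⟩, FN]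
  simp only [a.inner_u, mul_one]

theorem op_FN (f : ℂ → ℂ) (N : ℕ) : a.op N (a.FN f N) = a.FN (fun z => z * f z) N := by
  rw [FN, FN, map_sum]
  refine Finset.sum_congr rfl fun n _ => ?_
  rw [map_smul, op, a.eigen, smul_smul]
  congr 1
  ring

theorem norm_FN_sq (f : ℂ → ℂ) (N : ℕ) :
    ‖a.FN f N‖ ^ 2 = ∑ n, a.xi N n ^ 2 * ‖f (a.lam N n)‖ ^ 2 := by
  rw [← (a.u N).sum_sq_norm_inner_right]
  refine Finset.sum_congr rfl fun n _ => ?_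
  rw [FN, (a.u N).orthonormal.inner_right_fintype, norm_mul, mul_pow, Complex.norm_real,
    Real.norm_eq_abs, sq_abs]

theorem sum_xi_sq (N : ℕ) : ∑ n, a.xi N n ^ 2 = ‖φ‖ ^ 2 := by
  have h := a.norm_FN_sq (fun _ => 1) N
  rw [a.FN_one] at h
  simpa using h.symm

section

variable (hr : 0 < r) (hAr : ContinuousLinearMap.adjoint A * A = (r : ℂ) • 1)
include hr hAr

theorem lam_mul_conj (N : ℕ) (n) : a.lam N n * conj (a.lam N n) = r := by
  have h := inner_AN_AN hr hAr (a.V N) (a.u N n) (a.u N n)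
  rw [a.eigen, inner_smul_left, inner_smul_right, inner_self_eq_norm_sq_to_K,
    (a.u N).orthonormal.1 n] at h
  simpa [mul_comm] using h

theorem norm_lam (N : ℕ) (n) : ‖a.lam N n‖ = √r := by
  have h := a.lam_mul_conj hr hAr N n
  rw [Complex.mul_conj, Complex.normSq_eq_norm_sq] at h
  rw [← Real.sqrt_sq (norm_nonneg (a.lam N n)), (by exact_mod_cast h : ‖a.lam N n‖ ^ 2 = r)]

/-- From $A_N^*A_N=r$ one gets $\lambda A_N^*u=ru=\lambda\bar\lambda u$, and $\lambda\ne0$ cancels.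
-/
theorem adjoint_op_u (N : ℕ) (n) :
    LinearMap.adjoint (a.op N) (a.u N n) = conj (a.lam N n) • a.u N n := by
  have h0 : a.lam N n ≠ 0 := by
    rw [← norm_pos_iff, a.norm_lam hr hAr]; exact Real.sqrt_pos.2 hr
  have h := LinearMap.congr_fun (adjoint_AN_comp_AN hr hAr (a.V N)) (a.u N n)
  rw [LinearMap.comp_apply, a.eigen, map_smul, LinearMap.smul_apply, LinearMap.id_apply,
    ← a.lam_mul_conj hr hAr N n, mul_smul] at h
  exact smul_right_injective _ h0 h

theorem adjoint_op_FN (f : ℂ → ℂ) (N : ℕ) :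
    LinearMap.adjoint (a.op N) (a.FN f N) = a.FN (fun z => conj z * f z) N := by
  rw [FN, FN, map_sum]
  refine Finset.sum_congr rfl fun n _ => ?_
  rw [map_smul, a.adjoint_op_u hr hAr, smul_smul]
  congr 1
  ring

variable (hAr' : A * ContinuousLinearMap.adjoint A = (r : ℂ) • 1)
include hAr'

/-- The heart of the comparison. For $j+1\le N$ the vector $(A^*)^{j+1}\varphi$ lies in $H_N^-$,
where $A_N=A$, so $A_N$ sends it to $AA^*(A^*)^j\varphi=r(A^*)^j\varphi$. Applying $r^{-1}A_N^*$
shows that $A_N^*$ acts on $(A^*)^j\varphi$ as $A^*$ does. -/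
theorem coe_FN_conj_pow (N j : ℕ) (hj : j ≤ N) :
    (a.FN (fun z => conj z ^ j) N : H) = gen A φ 0 j := by
  induction j with
  | zero => simp only [pow_zero, a.FN_one]; simp [gen]
  | succ j ih =>
    have h1 : a.FN (fun z => conj z ^ j) N =
        a.op N ((r : ℂ)⁻¹ • ⟨gen A φ 0 (j + 1), gen_mem_HN (Nat.zero_le _) hj⟩) := by
      refine Subtype.ext ?_
      rw [ih (by omega), map_smul, Submodule.coe_smul, op, coe_AN_of_mem _
        (gen_mem_HNminus (by omega) hj)]
      have h := DFunLike.congr_fun hAr' (gen A φ 0 j)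
      have e : ContinuousLinearMap.adjoint A (gen A φ 0 j) = gen A φ 0 (j + 1) := by
        simp [gen, pow_succ']
      rw [mul_apply_eq_comp, e, smul_apply,
        one_apply_eq_self] at h
      rw [h, smul_smul, inv_mul_cancel₀ (by exact_mod_cast hr.ne'), one_smul]
    have h2 := a.adjoint_op_FN hr hAr (fun z => conj z ^ j) N
    rw [h1, map_smul, map_smul, ← LinearMap.comp_apply, op, adjoint_AN_comp_AN hr hAr,
      LinearMap.smul_apply, LinearMap.id_apply, smul_smul,
      inv_mul_cancel₀ (by exact_mod_cast hr.ne'), one_smul] at h2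
    simp only [← pow_succ'] at h2
    rw [← h2]

theorem coe_FN_pow_mul_conj_pow (N i j : ℕ) (hi : i ≤ N) (hj : j ≤ N) :
    (a.FN (fun z => z ^ i * conj z ^ j) N : H) = gen A φ i j := by
  induction i with
  | zero => simpa using a.coe_FN_conj_pow hr hAr hAr' N j hj
  | succ i ih =>
    -- The powers of $A$ come last: for $i<N$ the vector $A^i(A^*)^j\varphi$ is in $H_N^-$ for every
    -- $j\le N$, so $A_N$ raises $i$ correctly.
    have h2 := a.op_FN (fun z => z ^ i * conj z ^ j) N
    simp only [← mul_assoc, ← pow_succ'] at h2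
    rw [← h2, op, coe_AN_of_mem, ih (by omega), apply_gen]
    rw [ih (by omega)]
    exact gen_mem_HNminus (by omega) hj

theorem FmPoly_eq_GmPoly {D : Ultrafilter ℕ} (hD : (D : Filter ℕ) ≤ atTop) :
    a.FmPoly D = GmPoly A φ D := by
  refine LinearMap.ext fun P => ?_
  induction P using MvPolynomial.induction_on' with
  | monomial m c =>
    refine mk_eq_mk_of_eventually ?_
    filter_upwards [hD (eventually_ge_atTop (m 0)), hD (eventually_ge_atTop (m 1))] with N h0 h1
    refine Subtype.ext ?_
    rw [FinSeq.entry_of, FinSeq.entry_of, polyVec_monomial, map_smul, Submodule.coe_smul,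
      ← Submodule.starProjection_apply,
      Submodule.starProjection_eq_self_iff.2 (gen_mem_HN h0 h1),
      ← a.coe_FN_pow_mul_conj_pow hr hAr hAr' N _ _ h0 h1, ← Submodule.coe_smul, FN, FN,
      Finset.smul_sum]
    congr 1
    refine Finset.sum_congr rfl fun n _ => ?_
    rw [polyFun_monomial, smul_smul]
    congr 1
    ring
  | add p q hp hq => rw [map_add, map_add, hp, hq]

end

theorem Am_FmPoly (D : Ultrafilter ℕ) (P : MvPolynomial (Fin 2) ℂ) :
    a.Am D (a.FmPoly D P) = a.FmPoly D (MvPolynomial.X 0 * P) := by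
  refine (ultraMap_mk _ _ _ _).trans (mk_eq_mk_of_eventually (Eventually.of_forall fun N => ?_))
  refine (a.op_FN (polyFun P) N).trans ?_
  simp only [← polyFun_X_mul]
  rfl

/-- Once $P(A,A^*)\varphi\in H_N$ the projection fixes it, so the norms are eventually constant. -/
theorem norm_GmPoly {D : Ultrafilter ℕ} (hD : (D : Filter ℕ) ≤ atTop)
    (P : MvPolynomial (Fin 2) ℂ) : ‖GmPoly A φ D P‖ = ‖polyVec A φ P‖ := by
  refine (norm_mk _).trans (tendsto_nhds_unique (FinSeq.tendsto_norm _) ?_)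
  refine tendsto_const_nhds.congr' ?_
  filter_upwards [hD (eventually_polyVec_mem (A := A) (φ := φ) P)] with N hN
  exact (congrArg norm (Submodule.starProjection_eq_self_iff (K := HN A φ N).2 hN)).symm

end Approx

end SpectralUltra

/-! ### The weak limit of the measures $\mu_N$ and the existence of nice reals -/

namespace SpectralUltra

open MetricUltra

variable {H : Type*} [NormedAddCommGroup H] [InnerProductSpace ℂ H] [CompleteSpace H]
variable {A : H →L[ℂ] H} {φ : H}

namespace Approx

variable {r : ℝ} (a : Approx A φ r)

theorem muN_nonneg (N : ℕ) (X : Set ℂ) : 0 ≤ a.muN N X :=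
  Finset.sum_nonneg fun _ _ => Set.indicator_nonneg (fun _ _ => sq_nonneg _) _

theorem muN_mono (N : ℕ) {X Y : Set ℂ} (h : X ⊆ Y) : a.muN N X ≤ a.muN N Y :=
  Finset.sum_le_sum fun _ _ =>
    Set.indicator_le_indicator_of_subset h (fun _ => sq_nonneg _) _

theorem muN_union (N : ℕ) {X Y : Set ℂ} (h : Disjoint X Y) :
    a.muN N (X ∪ Y) = a.muN N X + a.muN N Y := by
  rw [muN, muN, muN, ← Finset.sum_add_distrib]
  refine Finset.sum_congr rfl fun n _ => ?_
  rw [Set.indicator_union_of_disjoint h]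

theorem muN_univ (N : ℕ) : a.muN N Set.univ = ‖φ‖ ^ 2 := by
  rw [← a.sum_xi_sq N, muN]
  simp

variable (D : Ultrafilter ℕ)

theorem tendsto_muN (X : Set ℂ) : Tendsto (fun N => a.muN N X) D (𝓝 (a.muNaive D X)) := by
  have hmem : (D.map (fun N => a.muN N X) : Filter ℝ) ≤ 𝓟 (Set.Icc 0 (‖φ‖ ^ 2)) := by
    rw [le_principal_iff]
    exact Eventually.of_forall (f := (D : Filter ℕ)) fun N => ⟨a.muN_nonneg N X,
      (a.muN_mono N (Set.subset_univ X)).trans (a.muN_univ N).le⟩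
  obtain ⟨x, -, hx⟩ := isCompact_Icc.ultrafilter_le_nhds _ hmem
  exact tendsto_nhds_limUnder ⟨x, hx⟩

theorem muNaive_nonneg (X : Set ℂ) : 0 ≤ a.muNaive D X :=
  ge_of_tendsto' (a.tendsto_muN D X) fun N => a.muN_nonneg N X

theorem muNaive_mono {X Y : Set ℂ} (h : X ⊆ Y) : a.muNaive D X ≤ a.muNaive D Y :=
  le_of_tendsto_of_tendsto' (a.tendsto_muN D X) (a.tendsto_muN D Y) fun N => a.muN_mono N h

theorem muNaive_union {X Y : Set ℂ} (h : Disjoint X Y) :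
    a.muNaive D (X ∪ Y) = a.muNaive D X + a.muNaive D Y :=
  tendsto_nhds_unique (a.tendsto_muN D _)
    (((a.tendsto_muN D X).add (a.tendsto_muN D Y)).congr fun N => (a.muN_union N h).symm)

theorem muNaive_univ : a.muNaive D Set.univ = ‖φ‖ ^ 2 :=
  tendsto_nhds_unique (a.tendsto_muN D _) (by simp only [a.muN_univ]; exact tendsto_const_nhds)

/-- The Borel probability measure `ν` on `ℂ` is the weak limit along `D` of the measures `μ_N`. -/
structure IsWeakLimit (ν : Measure ℂ) : Prop where
  isProbabilityMeasure : IsProbabilityMeasure ν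
  tendsto_sum : ∀ F : ℂ → ℝ, Continuous F →
    Tendsto (fun N => ∑ n, a.xi N n ^ 2 * F (a.lam N n)) D (𝓝 (∫ z, F z ∂ν))
  le_muNaive : ∀ U : Set ℂ, IsOpen U → ν U ≤ ENNReal.ofReal (a.muNaive D U)

/-- All eigenvalues have modulus $\sqrt r$, so the $\mu_N$ live on a compact disc, where the space
of probability measures is compact and every ultrafilter converges. The bound on open sets is the
portmanteau theorem, its liminf being a limit along $D$. -/
theorem exists_isWeakLimit (hφ : ‖φ‖ = 1) (hr : 0 < r)
    (hAr : ContinuousLinearMap.adjoint A * A = (r : ℂ) • 1) : ∃ ν, a.IsWeakLimit D ν := by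
  classical
  let K := Metric.closedBall (0 : ℂ) (√r)
  have : CompactSpace K := isCompact_iff_compactSpace.1 (isCompact_closedBall _ _)
  let p : ∀ N, Fin (Module.finrank ℂ (HN A φ N)) → K := fun N n =>
    ⟨a.lam N n, mem_closedBall_zero_iff.2 (a.norm_lam hr hAr N n).le⟩
  let m : ℕ → Measure K := fun N => ∑ n, ENNReal.ofReal (a.xi N n ^ 2) • Measure.dirac (p N n)
  have hmX : ∀ N (X : Set ℂ), MeasurableSet X →
      m N (Subtype.val ⁻¹' X) = ENNReal.ofReal (a.muN N X) := by
    intro N X hX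
    rw [muN, ENNReal.ofReal_sum_of_nonneg fun _ _ =>
      Set.indicator_nonneg (fun _ _ => sq_nonneg _) _, Measure.finsetSum_apply]
    refine Finset.sum_congr rfl fun n _ => ?_
    rw [Measure.smul_apply, Measure.dirac_apply' _ (measurable_subtype_coe hX)]
    by_cases h : a.lam N n ∈ X <;> simp [h, p]
  have hm1 : ∀ N, IsProbabilityMeasure (m N) := fun N => ⟨by
    rw [← Set.preimage_univ (f := Subtype.val), hmX N _ MeasurableSet.univ, muN_univ, hφ]; simp⟩
  have hmF : ∀ N (F : ℂ → ℝ), Continuous F →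
      ∫ z, F z ∂(m N) = ∑ n, a.xi N n ^ 2 * F (a.lam N n) := by
    intro N F hF
    rw [integral_finsetSum_measure]
    · refine Finset.sum_congr rfl fun n _ => ?_
      rw [integral_smul_measure, integral_dirac, ENNReal.toReal_ofReal (sq_nonneg _), smul_eq_mul]
    · intro n _
      exact (integrable_dirac (by simp)).smul_measure ENNReal.ofReal_ne_top
  let ρ : ℕ → ProbabilityMeasure K := fun N => ⟨m N, hm1 N⟩
  obtain ⟨ν, -, hν⟩ := isCompact_univ.ultrafilter_le_nhds (D.map ρ) (by simp)
  have hν : Tendsto ρ D (𝓝 ν) := hν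
  refine ⟨(ν : Measure K).map Subtype.val,
    Measure.isProbabilityMeasure_map measurable_subtype_coe.aemeasurable, fun F hF => ?_,
    fun U hU => ?_⟩
  · rw [integral_map measurable_subtype_coe.aemeasurable hF.aestronglyMeasurable]
    have h := ProbabilityMeasure.tendsto_iff_forall_integral_tendsto.1 hν
      (BoundedContinuousFunction.mkOfCompact ⟨fun z : K => F z, hF.comp continuous_subtype_val⟩)
    exact h.congr fun N => hmF N F hF
  · rw [Measure.map_apply measurable_subtype_coe hU.measurableSet]
    refine (ProbabilityMeasure.le_liminf_measure_open_of_tendsto hν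
      (hU.preimage continuous_subtype_val)).trans (le_of_eq ?_)
    refine Tendsto.liminf_eq ?_
    exact ((ENNReal.continuous_ofReal.tendsto _).comp (a.tendsto_muN D U)).congr fun N =>
      (hmX N U hU.measurableSet).symm

variable {a D}

namespace IsWeakLimit

variable {ν : Measure ℂ} (hν : a.IsWeakLimit D ν)
include hν

/-- Complement of the inequality for open sets: both $\nu$ and $\mu^n$ are additive with total mass
1. -/
theorem muNaive_le (hφ : ‖φ‖ = 1) {C : Set ℂ} (hC : IsClosed C) :
    ENNReal.ofReal (a.muNaive D C) ≤ ν C := by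
  have := hν.isProbabilityMeasure
  have h1 := hν.le_muNaive Cᶜ hC.isOpen_compl
  have h2 := a.muNaive_union D (disjoint_compl_right (a := C))
  rw [Set.union_compl_self, muNaive_univ, hφ, one_pow] at h2
  have h3 := measure_add_measure_compl (μ := ν) hC.measurableSet
  rw [measure_univ] at h3
  have h4 : ENNReal.ofReal (a.muNaive D C) + ENNReal.ofReal (a.muNaive D Cᶜ) = 1 := by
    rw [← ENNReal.ofReal_add (a.muNaive_nonneg D _) (a.muNaive_nonneg D _), ← h2,
      ENNReal.ofReal_one]
  refine (ENNReal.add_le_add_iff_right (a := ν Cᶜ) (measure_ne_top _ _)).1 ?_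
  rw [h3, ← h4]
  gcongr

theorem measure_norm_gt (hr : 0 < r)
    (hAr : ContinuousLinearMap.adjoint A * A = (r : ℂ) • 1) : ν {z | √r < ‖z‖} = 0 := by
  refine le_antisymm ((hν.le_muNaive _ (isOpen_lt continuous_const continuous_norm)).trans ?_)
    zero_le
  have : a.muNaive D {z | √r < ‖z‖} = 0 := by
    refine tendsto_nhds_unique (a.tendsto_muN D _) (tendsto_const_nhds.congr fun N => ?_)
    simp [muN, a.norm_lam hr hAr]
  simp [this]

/-- Closed strips shrink to the null set $\{g=t\}$, so their $\nu$-measure tends to 0, and on closed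
sets $\mu^n\le\nu$. Only $\nu$ is countably additive, hence the detour. -/
theorem exists_muNaive_strip_lt (hφ : ‖φ‖ = 1) {g : ℂ → ℝ} (hg : Continuous g) {t : ℝ}
    (ht : ν {z | g z = t} = 0) (s : Set ℂ) {δ : ℝ} (hδ : 0 < δ) :
    ∃ ε > 0, a.muNaive D {z | z ∈ s ∧ |g z - t| < ε} < δ := by
  have := hν.isProbabilityMeasure
  let S : ℕ → Set ℂ := fun k => {z | |g z - t| ≤ 1 / ((k : ℝ) + 1)}
  have hS : ∀ k, IsClosed (S k) := fun k =>
    isClosed_le (hg.sub continuous_const).abs continuous_const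
  have hanti : Antitone S := fun k l hkl z hz => by
    have hz : |g z - t| ≤ 1 / ((l : ℝ) + 1) := hz
    change |g z - t| ≤ 1 / ((k : ℝ) + 1)
    refine hz.trans (one_div_le_one_div_of_le (by positivity) ?_)
    gcongr
  have hinter : ⋂ k, S k = {z | g z = t} := by
    ext z
    simp only [S, Set.mem_iInter, Set.mem_ofPred_eq]
    constructor
    · intro h
      have := ge_of_tendsto' tendsto_one_div_add_atTop_nhds_zero_nat h
      exact sub_eq_zero.1 (abs_nonpos_iff.1 this)
    · intro h k
      rw [h, sub_self, abs_zero]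
      positivity
  have hlim := tendsto_measure_iInter_atTop (μ := ν)
    (fun k => (hS k).measurableSet.nullMeasurableSet) hanti ⟨0, measure_ne_top _ _⟩
  rw [hinter, ht] at hlim
  obtain ⟨k, hk⟩ := (hlim.eventually_lt_const (ENNReal.ofReal_pos.2 hδ)).exists
  refine ⟨1 / ((k : ℝ) + 1), by positivity, ?_⟩
  refine lt_of_le_of_lt (a.muNaive_mono D (Y := S k) fun z hz => hz.2.le) ?_
  exact (ENNReal.ofReal_lt_ofReal_iff hδ).1 ((hν.muNaive_le hφ (hS k)).trans_lt hk)

theorem isNice (hφ : ‖φ‖ = 1) (M : ℕ) {t : ℝ} (h1 : ν {z | z.re = t} = 0)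
    (h2 : ν {z | z.im = t} = 0) : a.IsNice D M t := by
  intro δ hδ
  obtain ⟨ε, hε, h⟩ := hν.exists_muNaive_strip_lt hφ Complex.continuous_re h1 (square M) hδ
  obtain ⟨ε', hε', h'⟩ := hν.exists_muNaive_strip_lt hφ Complex.continuous_im h2 (square M) hδ
  refine ⟨min ε ε', lt_min hε hε', (a.muNaive_mono D ?_).trans_lt h,
    (a.muNaive_mono D ?_).trans_lt h'⟩
  · exact fun z hz => ⟨hz.1, hz.2.trans_le (min_le_left _ _)⟩
  · exact fun z hz => ⟨hz.1, hz.2.trans_le (min_le_right _ _)⟩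

theorem nonempty_niceGrid (hφ : ‖φ‖ = 1) (hr : 0 < r)
    (hAr : ContinuousLinearMap.adjoint A * A = (r : ℂ) • 1) {M : ℕ} (hM : √r < M) :
    Nonempty (a.NiceGrid D M) := by
  have := hν.isProbabilityMeasure
  have hM0 : (0 : ℝ) < M := (Real.sqrt_nonneg r).trans_lt hM
  have hc : ({t | 0 < ν {z | z.re = t}} ∪ {t | 0 < ν {z | z.im = t}}).Countable :=
    (Measure.countable_meas_level_set_pos Complex.measurable_re).union
      (Measure.countable_meas_level_set_pos Complex.measurable_im)
  set B := {t | 0 < ν {z | z.re = t}} ∪ {t | 0 < ν {z | z.im = t}} with hB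
  obtain ⟨T, hT, hTc, hTd⟩ := (TopologicalSpace.IsSeparable.of_separableSpace
    (Set.Ioo (-(M : ℝ)) M ∩ Bᶜ)).exists_countable_dense_subset
  have hnice : ∀ t, t ∉ B → a.IsNice D M t := by
    intro t ht
    simp only [hB, Set.mem_union, Set.mem_ofPred_eq, not_or, not_lt, nonpos_iff_eq_zero] at ht
    exact hν.isNice hφ M ht.1 ht.2
  -- Lines at distance more than $\sqrt r$ from the origin miss the support of $\nu$; this makes
  -- $\pm M$ nice.
  have hedge : ∀ t : ℝ, √r < |t| → t ∉ B := by
    intro t ht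
    simp only [hB, Set.mem_union, Set.mem_ofPred_eq, not_or, not_lt, nonpos_iff_eq_zero]
    refine ⟨measure_mono_null ?_ (hν.measure_norm_gt hr hAr),
      measure_mono_null ?_ (hν.measure_norm_gt hr hAr)⟩
    · rintro z rfl; exact ht.trans_le (Complex.abs_re_le_norm z)
    · rintro z rfl; exact ht.trans_le (Complex.abs_im_le_norm z)
  refine ⟨⟨insert (-(M : ℝ)) (insert (M : ℝ) T), ?_, (hTc.insert _).insert _, ?_, ?_,
    Set.mem_insert _ _, Set.mem_insert_of_mem _ (Set.mem_insert _ _)⟩⟩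
  · rintro t (rfl | rfl | ht)
    · exact ⟨le_rfl, by linarith⟩
    · exact ⟨by linarith, le_rfl⟩
    · exact Set.Ioo_subset_Icc_self (hT ht).1
  · refine Set.Subset.trans ?_ (closure_mono (s := T) ?_)
    · rw [← closure_Ioo (by linarith)]
      refine closure_minimal ?_ isClosed_closure
      refine ((hc.dense_compl ℝ).open_subset_closure_inter isOpen_Ioo).trans ?_
      exact closure_minimal hTd isClosed_closure
    · exact (Set.subset_insert _ _).trans (Set.subset_insert _ _)
  · rintro t (rfl | rfl | ht)
    · exact hnice _ (hedge _ (by rwa [abs_neg, abs_of_pos hM0]))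
    · exact hnice _ (hedge _ (by rwa [abs_of_pos hM0]))
    · exact hnice _ (hT ht).2

end IsWeakLimit

end Approx

end SpectralUltra

/-! ### The outer measure $\mu^*$: measurability of Borel sets, and $\mu=\nu$ -/

namespace SpectralUltra

open MetricUltra

variable {H : Type*} [NormedAddCommGroup H] [InnerProductSpace ℂ H] [CompleteSpace H]
variable {A : H →L[ℂ] H} {φ : H}

theorem mem_interior_square {M : ℕ} {z : ℂ} :
    z ∈ interior (square M) ↔ (-(M : ℝ) < z.re ∧ z.re < M) ∧ (-(M : ℝ) < z.im ∧ z.im < M) := by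
  rw [square, Complex.interior_reProdIm, interior_Icc]
  rfl

theorem isClosed_square (M : ℕ) : IsClosed (square M) :=
  (isCompact_Icc.reProdIm isCompact_Icc).isClosed

/-- The open rectangle `(x₀, x₁) × (y₀, y₁)`. -/
def rect (x₀ x₁ y₀ y₁ : ℝ) : Set ℂ := {z | x₀ < z.re ∧ z.re < x₁ ∧ y₀ < z.im ∧ z.im < y₁}

theorem isOpen_rect (x₀ x₁ y₀ y₁ : ℝ) : IsOpen (rect x₀ x₁ y₀ y₁) :=
  (isOpen_lt continuous_const Complex.continuous_re).inter
    ((isOpen_lt Complex.continuous_re continuous_const).inter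
      ((isOpen_lt continuous_const Complex.continuous_im).inter
        (isOpen_lt Complex.continuous_im continuous_const)))

namespace Approx

variable {r : ℝ} {a : Approx A φ r} {D : Ultrafilter ℕ} {M : ℕ}

namespace NiceGrid

variable (NI : a.NiceGrid D M)

theorem isSq_iff {Y : Set ℂ} : NI.IsSq Y ↔ ∃ x₀ ∈ NI.carrier, ∃ x₁ ∈ NI.carrier,
    ∃ y₀ ∈ NI.carrier, ∃ y₁ ∈ NI.carrier, Y = rect x₀ x₁ y₀ y₁ := by
  have key : ∀ x₀ ∈ NI.carrier, ∀ x₁ ∈ NI.carrier, ∀ y₀ ∈ NI.carrier, ∀ y₁ ∈ NI.carrier,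
      {z | z ∈ square M ∧ x₀ < z.re ∧ z.re < x₁ ∧ y₀ < z.im ∧ z.im < y₁} = rect x₀ x₁ y₀ y₁ := by
    intro x₀ h₀ x₁ h₁ y₀ h₂ y₁ h₃
    ext z
    refine ⟨fun h => h.2, fun h => ⟨⟨⟨?_, ?_⟩, ?_, ?_⟩, h⟩⟩
    · exact (NI.subset h₀).1.trans h.1.le
    · exact h.2.1.le.trans (NI.subset h₁).2
    · exact (NI.subset h₂).1.trans h.2.2.1.le
    · exact h.2.2.2.le.trans (NI.subset h₃).2
  constructor
  · rintro ⟨x₀, h₀, x₁, h₁, y₀, h₂, y₁, h₃, rfl⟩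
    exact ⟨x₀, h₀, x₁, h₁, y₀, h₂, y₁, h₃, key x₀ h₀ x₁ h₁ y₀ h₂ y₁ h₃⟩
  · rintro ⟨x₀, h₀, x₁, h₁, y₀, h₂, y₁, h₃, rfl⟩
    exact ⟨x₀, h₀, x₁, h₁, y₀, h₂, y₁, h₃, (key x₀ h₀ x₁ h₁ y₀ h₂ y₁ h₃).symm⟩

/-- The outer measure induced by the naive measure of the rectangles in `Sq*`. -/
noncomputable def coverOuter : OuterMeasure ℂ :=
  inducedOuterMeasure (fun Y (_ : NI.IsSq Y) => ENNReal.ofReal (a.muNaive D Y))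
    NI.isSq_empty muNaive_empty

theorem outer_apply (X : Set ℂ) : NI.outer X = NI.coverOuter (X ∩ interior (square M)) := by
  rw [outer, OuterMeasure.restrict_apply]
  rfl

theorem coverOuter_rect_le {x₀ x₁ y₀ y₁ : ℝ} (h₀ : x₀ ∈ NI.carrier) (h₁ : x₁ ∈ NI.carrier)
    (h₂ : y₀ ∈ NI.carrier) (h₃ : y₁ ∈ NI.carrier) :
    NI.coverOuter (rect x₀ x₁ y₀ y₁) ≤ ENNReal.ofReal (a.muNaive D (rect x₀ x₁ y₀ y₁)) :=
  le_inducedOuterMeasure.1 le_rfl _ (NI.isSq_iff.2 ⟨x₀, h₀, x₁, h₁, y₀, h₂, y₁, h₃, rfl⟩)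

theorem exists_mem_Ioo {x y : ℝ} (hxy : x < y) (hx : -(M : ℝ) ≤ x) (hy : y ≤ M) :
    ∃ t ∈ NI.carrier, x < t ∧ t < y := by
  obtain ⟨z, hz⟩ := exists_between hxy
  have hmem : z ∈ closure NI.carrier := NI.dense ⟨hx.trans hz.1.le, hz.2.le.trans hy⟩
  obtain ⟨t, ht, htc⟩ := mem_closure_iff.1 hmem _ isOpen_Ioo hz
  exact ⟨t, htc, ht⟩

theorem exists_mem_near {x₀ x₁ t ε : ℝ} (h₀ : x₀ ∈ NI.carrier) (h₁ : x₁ ∈ NI.carrier)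
    (ht₀ : x₀ < t) (ht₁ : t < x₁) (hε : 0 < ε) :
    ∃ p ∈ NI.carrier, ∃ q ∈ NI.carrier, t - ε < p ∧ p < t ∧ t < q ∧ q < t + ε := by
  obtain ⟨p, hp, hp1, hp2⟩ := NI.exists_mem_Ioo (max_lt ht₀ (sub_lt_self t hε))
    ((NI.subset h₀).1.trans (le_max_left _ _)) (ht₁.le.trans (NI.subset h₁).2)
  obtain ⟨q, hq, hq1, hq2⟩ := NI.exists_mem_Ioo (lt_min ht₁ (lt_add_of_pos_right t hε))
    ((NI.subset h₀).1.trans ht₀.le) ((min_le_left _ _).trans (NI.subset h₁).2)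
  exact ⟨p, hp, q, hq, (le_max_right _ _).trans_lt hp1, hp2, hq1, hq2.trans_le (min_le_right _ _)⟩

/-- Niceness of $t$ and density of the grid provide a single thin rectangle of $Sq^*$ that covers
the segment and has naive measure below $\delta$. -/
theorem coverOuter_rect_inter_re_eq {x₀ x₁ y₀ y₁ t : ℝ} (h₀ : x₀ ∈ NI.carrier)
    (h₁ : x₁ ∈ NI.carrier) (h₂ : y₀ ∈ NI.carrier) (h₃ : y₁ ∈ NI.carrier) (ht : t ∈ NI.carrier) :
    NI.coverOuter (rect x₀ x₁ y₀ y₁ ∩ {z | z.re = t}) = 0 := by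
  by_cases hx : x₀ < t ∧ t < x₁
  · refine le_antisymm (ENNReal.le_of_forall_pos_le_add fun δ hδ _ => ?_) zero_le
    obtain ⟨ε, hε, hlt, -⟩ := NI.nice t ht δ (by exact_mod_cast hδ)
    obtain ⟨p, hp, q, hq, h1, h2, h3, h4⟩ := NI.exists_mem_near h₀ h₁ hx.1 hx.2 hε
    calc NI.coverOuter (rect x₀ x₁ y₀ y₁ ∩ {z | z.re = t})
        ≤ NI.coverOuter (rect p q y₀ y₁) := by
          refine measure_mono ?_
          rintro z ⟨hz, rfl⟩
          exact ⟨h2, h3, hz.2.2⟩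
      _ ≤ ENNReal.ofReal (a.muNaive D (rect p q y₀ y₁)) := NI.coverOuter_rect_le hp hq h₂ h₃
      _ ≤ ENNReal.ofReal δ := by
          refine ENNReal.ofReal_le_ofReal ((a.muNaive_mono D ?_).trans hlt.le)
          rintro z ⟨ha, hb, hc, hd⟩
          refine ⟨⟨⟨?_, ?_⟩, ?_, ?_⟩, abs_lt.2 ⟨by linarith, by linarith⟩⟩
          · exact (NI.subset hp).1.trans ha.le
          · exact hb.le.trans (NI.subset hq).2
          · exact (NI.subset h₂).1.trans hc.le
          · exact hd.le.trans (NI.subset h₃).2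
      _ ≤ 0 + δ := by simp
  · convert! measure_empty (μ := NI.coverOuter)
    ext z
    simp only [Set.mem_inter_iff, Set.mem_ofPred_eq, Set.mem_empty_iff_false, iff_false]
    rintro ⟨hz, rfl⟩
    exact hx ⟨hz.1, hz.2.1⟩

theorem coverOuter_rect_inter_im_eq {x₀ x₁ y₀ y₁ t : ℝ} (h₀ : x₀ ∈ NI.carrier)
    (h₁ : x₁ ∈ NI.carrier) (h₂ : y₀ ∈ NI.carrier) (h₃ : y₁ ∈ NI.carrier) (ht : t ∈ NI.carrier) :
    NI.coverOuter (rect x₀ x₁ y₀ y₁ ∩ {z | z.im = t}) = 0 := by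
  by_cases hx : y₀ < t ∧ t < y₁
  · refine le_antisymm (ENNReal.le_of_forall_pos_le_add fun δ hδ _ => ?_) zero_le
    obtain ⟨ε, hε, -, hlt⟩ := NI.nice t ht δ (by exact_mod_cast hδ)
    obtain ⟨p, hp, q, hq, h1, h2, h3, h4⟩ := NI.exists_mem_near h₂ h₃ hx.1 hx.2 hε
    calc NI.coverOuter (rect x₀ x₁ y₀ y₁ ∩ {z | z.im = t})
        ≤ NI.coverOuter (rect x₀ x₁ p q) := by
          refine measure_mono ?_
          rintro z ⟨hz, rfl⟩
          exact ⟨hz.1, hz.2.1, h2, h3⟩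
      _ ≤ ENNReal.ofReal (a.muNaive D (rect x₀ x₁ p q)) := NI.coverOuter_rect_le h₀ h₁ hp hq
      _ ≤ ENNReal.ofReal δ := by
          refine ENNReal.ofReal_le_ofReal ((a.muNaive_mono D ?_).trans hlt.le)
          rintro z ⟨ha, hb, hc, hd⟩
          refine ⟨⟨⟨?_, ?_⟩, ?_, ?_⟩, abs_lt.2 ⟨by linarith, by linarith⟩⟩
          · exact (NI.subset h₀).1.trans ha.le
          · exact hb.le.trans (NI.subset h₁).2
          · exact (NI.subset hp).1.trans hc.le
          · exact hd.le.trans (NI.subset hq).2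
      _ ≤ 0 + δ := by simp
  · convert! measure_empty (μ := NI.coverOuter)
    ext z
    simp only [Set.mem_inter_iff, Set.mem_ofPred_eq, Set.mem_empty_iff_false, iff_false]
    rintro ⟨hz, rfl⟩
    exact hx hz.2.2

theorem coverOuter_isCaratheodory_of_rect {s : Set ℂ}
    (h : ∀ x₀ ∈ NI.carrier, ∀ x₁ ∈ NI.carrier, ∀ y₀ ∈ NI.carrier, ∀ y₁ ∈ NI.carrier,
      NI.coverOuter (rect x₀ x₁ y₀ y₁ ∩ s) + NI.coverOuter (rect x₀ x₁ y₀ y₁ ∩ sᶜ) ≤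
        ENNReal.ofReal (a.muNaive D (rect x₀ x₁ y₀ y₁))) :
    NI.coverOuter.IsCaratheodory s := by
  rw [OuterMeasure.isCaratheodory_iff_le']
  -- The left side is again an outer measure, so by maximality of the induced outer measure it
  -- suffices to compare on the covering rectangles.
  have hle : OuterMeasure.restrict s NI.coverOuter + OuterMeasure.restrict sᶜ NI.coverOuter ≤
      NI.coverOuter := by
    refine le_inducedOuterMeasure.2 fun Y hY => ?_
    obtain ⟨x₀, h₀, x₁, h₁, y₀, h₂, y₁, h₃, rfl⟩ := NI.isSq_iff.1 hY
    simpa [OuterMeasure.restrict_apply] using h x₀ h₀ x₁ h₁ y₀ h₂ y₁ h₃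
  intro T
  have := hle T
  simpa only [add_apply, OuterMeasure.restrict_apply, ← Set.sdiff_eq] using this

/-- The line $g=t$ cuts a rectangle into two members of $Sq^*$ and a null segment; finite additivity
of $\mu^n$ on the two pieces gives the Carathéodory inequality. -/
theorem coverOuter_isCaratheodory_of_split {g : ℂ → ℝ} {t : ℝ}
    (h : ∀ x₀ ∈ NI.carrier, ∀ x₁ ∈ NI.carrier, ∀ y₀ ∈ NI.carrier, ∀ y₁ ∈ NI.carrier,
      NI.IsSq (rect x₀ x₁ y₀ y₁ ∩ {z | g z < t}) ∧ NI.IsSq (rect x₀ x₁ y₀ y₁ ∩ {z | t < g z}) ∧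
        NI.coverOuter (rect x₀ x₁ y₀ y₁ ∩ {z | g z = t}) = 0) :
    NI.coverOuter.IsCaratheodory {z | g z < t} := by
  refine NI.coverOuter_isCaratheodory_of_rect fun x₀ h₀ x₁ h₁ y₀ h₂ y₁ h₃ => ?_
  obtain ⟨e1, e2, e3⟩ := h x₀ h₀ x₁ h₁ y₀ h₂ y₁ h₃
  set Y := rect x₀ x₁ y₀ y₁
  have hsub : Y ∩ {z | g z < t}ᶜ ⊆ (Y ∩ {z | t < g z}) ∪ (Y ∩ {z | g z = t}) := by
    rintro z ⟨hz, hz'⟩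
    rcases (show t ≤ g z from not_lt.1 hz').lt_or_eq with h | h
    · exact Or.inl ⟨hz, h⟩
    · exact Or.inr ⟨hz, h.symm⟩
  have hle : NI.coverOuter (Y ∩ {z | g z < t}ᶜ) ≤ NI.coverOuter (Y ∩ {z | t < g z}) := by
    refine (measure_mono hsub).trans ((measure_union_le _ _).trans ?_)
    rw [e3, add_zero]
  refine (add_le_add (le_inducedOuterMeasure.1 le_rfl _ e1)
    (hle.trans (le_inducedOuterMeasure.1 le_rfl _ e2))).trans ?_
  rw [← ENNReal.ofReal_add (a.muNaive_nonneg D _) (a.muNaive_nonneg D _), ← a.muNaive_union D]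
  · exact ENNReal.ofReal_le_ofReal (a.muNaive_mono D
      (Set.union_subset Set.inter_subset_left Set.inter_subset_left))
  · exact Set.disjoint_left.2 fun z hz hz' => lt_asymm (show g z < t from hz.2) hz'.2

theorem max_mem {s t : ℝ} (hs : s ∈ NI.carrier) (ht : t ∈ NI.carrier) : max s t ∈ NI.carrier := by
  rcases max_choice s t with h | h <;> rwa [h]

theorem min_mem {s t : ℝ} (hs : s ∈ NI.carrier) (ht : t ∈ NI.carrier) : min s t ∈ NI.carrier := by
  rcases min_choice s t with h | h <;> rwa [h]

theorem coverOuter_isCaratheodory_re_lt {t : ℝ} (ht : t ∈ NI.carrier) :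
    NI.coverOuter.IsCaratheodory {z | z.re < t} := by
  refine NI.coverOuter_isCaratheodory_of_split fun x₀ h₀ x₁ h₁ y₀ h₂ y₁ h₃ =>
    ⟨NI.isSq_iff.2 ⟨x₀, h₀, min x₁ t, NI.min_mem h₁ ht, y₀, h₂, y₁, h₃, ?_⟩,
    NI.isSq_iff.2 ⟨max x₀ t, NI.max_mem h₀ ht, x₁, h₁, y₀, h₂, y₁, h₃, ?_⟩,
    NI.coverOuter_rect_inter_re_eq h₀ h₁ h₂ h₃ ht⟩
  · ext z
    simp only [rect, Set.mem_inter_iff, Set.mem_ofPred_eq, lt_min_iff]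
    tauto
  · ext z
    simp only [rect, Set.mem_inter_iff, Set.mem_ofPred_eq, max_lt_iff]
    tauto

theorem coverOuter_isCaratheodory_im_lt {t : ℝ} (ht : t ∈ NI.carrier) :
    NI.coverOuter.IsCaratheodory {z | z.im < t} := by
  refine NI.coverOuter_isCaratheodory_of_split fun x₀ h₀ x₁ h₁ y₀ h₂ y₁ h₃ =>
    ⟨NI.isSq_iff.2 ⟨x₀, h₀, x₁, h₁, y₀, h₂, min y₁ t, NI.min_mem h₃ ht, ?_⟩,
    NI.isSq_iff.2 ⟨x₀, h₀, x₁, h₁, max y₀ t, NI.max_mem h₂ ht, y₁, h₃, ?_⟩,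
    NI.coverOuter_rect_inter_im_eq h₀ h₁ h₂ h₃ ht⟩
  · ext z
    simp only [rect, Set.mem_inter_iff, Set.mem_ofPred_eq, lt_min_iff]
    tauto
  · ext z
    simp only [rect, Set.mem_inter_iff, Set.mem_ofPred_eq, max_lt_iff]
    tauto

theorem isCaratheodory_outer_of_inter_eq {s s' : Set ℂ}
    (h : interior (square M) ∩ s = interior (square M) ∩ s')
    (hs' : NI.coverOuter.IsCaratheodory s') : NI.outer.IsCaratheodory s := by
  intro T
  have h1 : T ∩ s ∩ interior (square M) = T ∩ interior (square M) ∩ s' := by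
    rw [Set.inter_assoc, Set.inter_comm s, h, Set.inter_assoc]
  have h2 : (T \ s) ∩ interior (square M) = (T ∩ interior (square M)) \ s' := by
    ext z
    have hz := Set.ext_iff.1 h z
    simp only [Set.mem_inter_iff, Set.mem_sdiff] at hz ⊢
    tauto
  rw [outer_apply, outer_apply, outer_apply, h1, h2]
  exact hs' _

theorem measurable_caratheodory_of_lt {g : ℂ → ℝ}
    (hg : ∀ z ∈ interior (square M), -(M : ℝ) < g z ∧ g z < M)
    (h : ∀ t ∈ NI.carrier, NI.coverOuter.IsCaratheodory {z | g z < t}) :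
    Measurable[NI.outer.caratheodory] g := by
  let _ : MeasurableSpace ℂ := NI.outer.caratheodory
  refine measurable_of_Iio fun s => ?_
  -- An arbitrary threshold $s$ is reached from grid points $t\le s$. Equality holds only inside
  -- $\mathrm{Int}(S)$, which is all that $\mu^*$ sees; for $s>M$ the grid point $M$ already gives
  -- everything.
  refine NI.isCaratheodory_outer_of_inter_eq
    (s' := ⋃ t ∈ {t ∈ NI.carrier | t ≤ s}, {z | g z < t}) ?_ ?_
  · ext z
    simp only [Set.mem_inter_iff, Set.mem_preimage, Set.mem_Iio, Set.mem_iUnion, Set.mem_ofPred_eq,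
      exists_prop, and_congr_right_iff]
    intro hz
    constructor
    · intro hs
      obtain ⟨h1, h2⟩ := hg z hz
      by_cases hsM : s ≤ M
      · obtain ⟨t, ht, ht1, ht2⟩ := NI.exists_mem_Ioo hs h1.le hsM
        exact ⟨t, ⟨ht, ht2.le⟩, ht1⟩
      · exact ⟨M, ⟨NI.right_mem, (not_le.1 hsM).le⟩, h2⟩
    · rintro ⟨t, ⟨-, ht⟩, hz⟩
      exact hz.trans_le ht
  · have hc : {t ∈ NI.carrier | t ≤ s}.Countable := NI.countable.mono fun _ ht => ht.1
    exact MeasurableSet.biUnion (m := NI.coverOuter.caratheodory) hc fun t ht => h t ht.1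

theorem borel_le_caratheodory : Complex.measurableSpace ≤ NI.outer.caratheodory := by
  have hre := NI.measurable_caratheodory_of_lt (g := Complex.re)
    (fun z hz => (mem_interior_square.1 hz).1) fun t => NI.coverOuter_isCaratheodory_re_lt
  have him := NI.measurable_caratheodory_of_lt (g := Complex.im)
    (fun z hz => (mem_interior_square.1 hz).2) fun t => NI.coverOuter_isCaratheodory_im_lt
  -- Measurability of the identity, assembled from its real and imaginary parts, is exactly the
  -- inclusion of σ-algebras.
  have hid : Measurable[NI.outer.caratheodory, Complex.measurableSpace] (id : ℂ → ℂ) :=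
    Complex.measurableEquivRealProd.symm.measurable.comp
      (hre.prodMk him)
  exact fun s hs => hid hs

theorem measureC_apply {X : Set ℂ} (hX : MeasurableSet X) : NI.measureC X = NI.outer X := by
  rw [measureC, dif_pos NI.borel_le_caratheodory, toMeasure_apply _ _ hX]

theorem measure_apply {X : Set (square M)} (hX : MeasurableSet X) :
    NI.measure X = NI.outer (Subtype.val '' X) := by
  have hS := (isClosed_square M).measurableSet
  rw [measure, comap_subtype_coe_apply hS, NI.measureC_apply (hS.subtype_image hX)]

/-- Covers consist of open sets, on which $\nu\le\mu^n$, so $\nu\le\mu$; finite measures so ordered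
are equal once their total masses agree. -/
theorem measureC_eq {ν : Measure ℂ} (hν : a.IsWeakLimit D ν) (hφ : ‖φ‖ = 1) (hr : 0 < r)
    (hAr : ContinuousLinearMap.adjoint A * A = (r : ℂ) • 1) (hM : √r < M) : NI.measureC = ν := by
  have := hν.isProbabilityMeasure
  have hnull : ν (interior (square M))ᶜ = 0 := by
    refine measure_mono_null ?_ (hν.measure_norm_gt hr hAr)
    intro z hz
    by_contra h
    refine hz (mem_interior_square.2 ?_)
    have h1 : ‖z‖ < M := (not_lt.1 h).trans_lt hM
    exact ⟨abs_lt.1 ((Complex.abs_re_le_norm z).trans_lt h1),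
      abs_lt.1 ((Complex.abs_im_le_norm z).trans_lt h1)⟩
  have hcover : ν.toOuterMeasure ≤ NI.coverOuter := by
    refine le_inducedOuterMeasure.2 fun Y hY => ?_
    obtain ⟨x₀, h₀, x₁, h₁, y₀, h₂, y₁, h₃, rfl⟩ := NI.isSq_iff.1 hY
    exact hν.le_muNaive _ (isOpen_rect _ _ _ _)
  have hle : ν ≤ NI.measureC := by
    refine Measure.le_iff.2 fun X hX => ?_
    rw [NI.measureC_apply hX, outer_apply]
    refine le_trans ?_ (hcover _)
    rw [Measure.coe_toOuterMeasure, measure_inter_conull hnull]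
  refine (Measure.eq_of_le_of_measure_univ_eq hle (le_antisymm (hle _) ?_)).symm
  rw [NI.measureC_apply MeasurableSet.univ, outer_apply, Set.univ_inter, measure_univ]
  have hrect : interior (square M) = rect (-M) M (-M) M := by
    ext z
    rw [mem_interior_square, rect, Set.mem_ofPred_eq, and_assoc]
  rw [hrect]
  refine (NI.coverOuter_rect_le NI.left_mem NI.right_mem NI.left_mem NI.right_mem).trans ?_
  rw [← ENNReal.ofReal_one]
  refine ENNReal.ofReal_le_ofReal ((a.muNaive_mono D (Set.subset_univ _)).trans ?_)
  rw [muNaive_univ, hφ, one_pow]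

end NiceGrid

end Approx

end SpectralUltra

/-! ### Isometric extension, density of polynomials and multiplication by $z$ -/

theorem LinearMap.norm_extendOfNorm_eq {P E F : Type*} [AddCommGroup P] [Module ℂ P]
    [NormedAddCommGroup E] [NormedSpace ℂ E] [NormedAddCommGroup F] [NormedSpace ℂ F]
    [CompleteSpace F] {f : P →ₗ[ℂ] F} {e : P →ₗ[ℂ] E} (he : DenseRange e)
    (h : ∀ x, ‖f x‖ = ‖e x‖) (y : E) : ‖f.extendOfNorm e y‖ = ‖y‖ := by
  refine he.induction_on (p := fun y => ‖f.extendOfNorm e y‖ = ‖y‖) y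
    (isClosed_eq (by fun_prop) (by fun_prop)) fun x => ?_
  rw [LinearMap.extendOfNorm_eq he ⟨1, fun x => by rw [h, one_mul]⟩, h]

/-- An isometry from a complete space has closed range, so containing the images of a dense set is
enough. -/
theorem ContinuousLinearMap.range_le_range_of_dense {P E E' F : Type*}
    [NormedAddCommGroup E] [NormedSpace ℂ E] [NormedAddCommGroup E'] [NormedSpace ℂ E']
    [CompleteSpace E'] [NormedAddCommGroup F] [NormedSpace ℂ F]
    {e : P → E} {e' : P → E'} (he : DenseRange e) {f : E →L[ℂ] F} {f' : E' →L[ℂ] F}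
    (hf' : ∀ y, ‖f' y‖ = ‖y‖) (h : ∀ x, f (e x) = f' (e' x)) :
    LinearMap.range f.toLinearMap ≤ LinearMap.range f'.toLinearMap := by
  have hiso : Isometry f' := AddMonoidHomClass.isometry_of_norm f' hf'
  rintro _ ⟨y, rfl⟩
  refine he.induction_on (p := fun y => f y ∈ Set.range f') y
    (hiso.isClosedEmbedding.isClosed_range.preimage f.continuous) fun x => ?_
  exact ⟨e' x, (h x).symm⟩

theorem ContinuousLinearMap.exists_linearIsometryEquiv_range {E F : Type*}
    [NormedAddCommGroup E] [NormedSpace ℂ E] [NormedAddCommGroup F] [NormedSpace ℂ F]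
    (f : E →L[ℂ] F) (hf : ∀ y, ‖f y‖ = ‖y‖) {S : Submodule ℂ F}
    (hS : LinearMap.range f.toLinearMap = S) :
    ∃ Φ : E ≃ₗᵢ[ℂ] S, ∀ y, (Φ y : F) = f y := by
  subst hS
  exact ⟨LinearIsometry.equivRange ⟨f.toLinearMap, hf⟩, fun y => rfl⟩

namespace SpectralUltra

open MetricUltra

variable {H : Type*} [NormedAddCommGroup H] [InnerProductSpace ℂ H] [CompleteSpace H]
variable {A : H →L[ℂ] H} {φ : H}

/-- The continuous function `f_P` on the square. -/
noncomputable def polyMap (M : ℕ) (P : MvPolynomial (Fin 2) ℂ) : C(square M, ℂ) :=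
  ⟨fun z => polyFun P z, (continuous_polyFun P).comp continuous_subtype_val⟩

/-- Stone–Weierstrass: the star subalgebra generated by the coordinate $z$ consists of functions
$f_P$. -/
theorem denseRange_polyMap (M : ℕ) : DenseRange (polyMap M) := by
  have hsub : ((polynomialFunctions (square M)).starClosure : Set C(square M, ℂ)) ⊆
      Set.range (polyMap M) := by
    intro f hf
    rw [polynomialFunctions.starClosure_eq_adjoin_X] at hf
    induction hf using Algebra.adjoin_induction with
    | mem f hf =>
      push _ ∈ _ at hf
      rw [star_eq_iff_star_eq, eq_comm (b := f)] at hf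
      obtain (rfl | rfl) := hf
      · exact ⟨MvPolynomial.X 0, by ext z; simp [polyMap, polyFun]⟩
      · exact ⟨MvPolynomial.X 1, by ext z; simp [polyMap, polyFun]⟩
    | algebraMap c => exact ⟨MvPolynomial.C c, by ext z; simp [polyMap, polyFun]⟩
    | add f g _ _ hf hg =>
      obtain ⟨P, rfl⟩ := hf
      obtain ⟨Q, rfl⟩ := hg
      exact ⟨P + Q, by ext z; simp [polyMap, polyFun]⟩
    | mul f g _ _ hf hg =>
      obtain ⟨P, rfl⟩ := hf
      obtain ⟨Q, rfl⟩ := hg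
      exact ⟨P * Q, by ext z; simp [polyMap, polyFun]⟩
  have htop := polynomialFunctions.starClosure_topologicalClosure (square M)
  refine Dense.mono hsub fun f => ?_
  rw [← StarSubalgebra.topologicalClosure_coe, htop]
  trivial

namespace Approx

variable {r : ℝ} {a : Approx A φ r} {D : Ultrafilter ℕ} {M : ℕ}

namespace NiceGrid

variable (NI : a.NiceGrid D M)

theorem polyL2_eq (P : MvPolynomial (Fin 2) ℂ) :
    NI.polyL2 P = ContinuousMap.toLp 2 NI.measure ℂ (polyMap M P) := rfl

theorem denseRange_polyL2 : DenseRange NI.polyL2 :=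
  (ContinuousMap.toLp_denseRange (p := 2) NI.measure ℂ (E := ℂ) (by simp)).comp
    (denseRange_polyMap M) (ContinuousLinearMap.continuous _)

/-- Multiplication by `z` on `L₂(S, μ)`. -/
noncomputable def mulZ : NI.L2 →L[ℂ] NI.L2 :=
  -- The coordinate is bounded on the compact $S$, so Hölder's inequality $L_\infty\times L_2\to
  -- L_2$ gives continuity.
  (ContinuousLinearMap.mul ℂ ℂ).holderL NI.measure ∞ 2 2
    (ContinuousMap.toLp ∞ NI.measure ℂ (ContinuousMap.restrict (square M) (ContinuousMap.id ℂ)))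

theorem mulZ_ae_eq (f : NI.L2) : NI.mulZ f =ᵐ[NI.measure] fun z => (z : ℂ) * f z := by
  have h1 := (ContinuousLinearMap.mul ℂ ℂ).coeFn_holder (r := 2) (ContinuousMap.toLp ∞ NI.measure ℂ
    (ContinuousMap.restrict (square M) (ContinuousMap.id ℂ))) f
  have h2 := ContinuousMap.coeFn_toLp (p := ∞) (𝕜 := ℂ) NI.measure
    (ContinuousMap.restrict (square M) (ContinuousMap.id ℂ))
  filter_upwards [h1, h2] with z h1 h2
  refine h1.trans ?_
  rw [h2]
  rfl

theorem mulZ_polyL2 (P : MvPolynomial (Fin 2) ℂ) :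
    NI.mulZ (NI.polyL2 P) = NI.polyL2 (MvPolynomial.X 0 * P) := by
  refine Lp.ext ?_
  filter_upwards [NI.mulZ_ae_eq (NI.polyL2 P),
    ContinuousMap.coeFn_toLp (p := 2) (𝕜 := ℂ) NI.measure (polyMap M P),
    ContinuousMap.coeFn_toLp (p := 2) (𝕜 := ℂ) NI.measure (polyMap M (MvPolynomial.X 0 * P))]
    with z h1 h2 h3
  rw [h1, polyL2_eq, polyL2_eq, h2, h3]
  exact (polyFun_X_mul P z).symm

theorem AD_eq_mulZ : NI.AD = NI.mulZ := by
  refine LinearMap.extendOfNorm_unique NI.denseRange_polyL2 ‖NI.mulZ‖ (fun P => ?_) _ ?_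
  · rw [LinearMap.comp_apply, LinearMap.mulLeft_apply, ← mulZ_polyL2]
    exact NI.mulZ.le_opNorm _
  · exact LinearMap.ext fun P => NI.mulZ_polyL2 P

theorem norm_polyL2_sq (P : MvPolynomial (Fin 2) ℂ) :
    ‖NI.polyL2 P‖ ^ 2 = ∫ z, ‖polyFun P z‖ ^ 2 ∂NI.measureC := by
  have hS := (isClosed_square M).measurableSet
  have hnull : NI.measureC (square M)ᶜ = 0 := by
    rw [NI.measureC_apply hS.compl, outer_apply]
    convert! measure_empty (μ := NI.coverOuter)
    exact Set.eq_empty_of_forall_notMem fun z hz => hz.1 (interior_subset hz.2)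
  have h1 : ((‖NI.polyL2 P‖ ^ 2 : ℝ) : ℂ) = ((∫ z, ‖polyFun P z‖ ^ 2 ∂NI.measureC : ℝ) : ℂ) := by
    have h := inner_self_eq_norm_sq_to_K (𝕜 := ℂ) (NI.polyL2 P)
    rw [polyL2_eq, ContinuousMap.inner_toLp] at h
    rw [polyL2_eq]
    push_cast
    refine h.symm.trans ?_
    rw [← integral_complex_ofReal, ← Measure.restrict_eq_self_of_ae_mem
      (s := square M) (μ := NI.measureC) (by rw [ae_iff]; exact hnull),
      ← integral_subtype_comap hS]
    refine integral_congr_ae (Eventually.of_forall fun z => ?_)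
    change polyFun P z * conj (polyFun P z) = _
    rw [Complex.mul_conj, Complex.normSq_eq_norm_sq]
  exact_mod_cast h1

/-- Both squared norms are the limit along $D$ of $\sum_n\xi_N(n)^2|f_P(\lambda_N(n))|^2$: one by
Parseval in $H_N$, the other by weak convergence tested on $|f_P|^2$. -/
theorem norm_FmPoly {ν : Measure ℂ} (hν : a.IsWeakLimit D ν) (hNI : NI.measureC = ν)
    (P : MvPolynomial (Fin 2) ℂ) : ‖a.FmPoly D P‖ = ‖NI.polyL2 P‖ := by
  refine (pow_left_inj₀ (norm_nonneg _) (norm_nonneg _) two_ne_zero).1 ?_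
  rw [norm_polyL2_sq, hNI]
  refine tendsto_nhds_unique ?_ (hν.tendsto_sum (fun z => ‖polyFun P z‖ ^ 2)
    ((continuous_polyFun P).norm.pow 2))
  have h := (FinSeq.tendsto_norm (FinSeq.of (D := D) (a.FN (polyFun P))
    ((a.FN_bdd (continuous_polyFun P)).imp fun _ h => Eventually.of_forall h))).pow 2
  rw [← norm_mk] at h
  exact h.congr fun N => a.norm_FN_sq (polyFun P) N

end NiceGrid

end Approx

theorem le_atTop_of_mem {D : Ultrafilter ℕ}
    (hD : ∀ m : ℕ, m ≠ 0 → {N : ℕ | N ≠ 0 ∧ ∃ k, N = k ^ 2 ∧ m ∣ k} ∈ D) :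
    (D : Filter ℕ) ≤ atTop := by
  refine (atTop_basis (α := ℕ)).ge_iff.2 fun m _ => ?_
  -- A nonzero square $k^2$ with $(m+1)\mid k$ exceeds $m$, so $D$ contains every tail.
  filter_upwards [hD (m + 1) m.succ_ne_zero]
  rintro N ⟨hN, k, rfl, hk⟩
  have hk0 : 0 < k := Nat.pos_of_ne_zero fun h => hN (by simp [h])
  have := Nat.le_of_dvd hk0 hk
  exact Set.mem_Ici.2 (by nlinarith)

end SpectralUltra

/-! ### Assembly of the theorem -/

open SpectralUltra SpectralUltra.Approx in
theorem corollary2p4 {H : Type*} [NormedAddCommGroup H] [InnerProductSpace ℂ H] [CompleteSpace H]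
    [TopologicalSpace.SeparableSpace H]
    (A : H →L[ℂ] H)
    (hA : ∃ q : ℂ, q ≠ 0 ∧ ∃ U ∈ unitary (H →L[ℂ] H), A = q • U)
    (r : ℝ) (hr : 0 < r)
    (hAr : ContinuousLinearMap.adjoint A * A = (r : ℂ) • 1)
    (φ : H) (hφ : ‖φ‖ = 1) (hcyc : IsCyclicVec A φ)
    (M : ℕ) (hM : ‖A‖ < M) (hMr : √r < M)
    (D : Ultrafilter ℕ)
    (hD : ∀ m : ℕ, m ≠ 0 → {N : ℕ | N ≠ 0 ∧ ∃ k, N = k ^ 2 ∧ m ∣ k} ∈ D) :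
    Nonempty (Approx A φ r) ∧ ∀ a : Approx A φ r,
      (∀ N, LinearMap.adjoint (a.op N) ∘ₗ a.op N = (r : ℂ) • LinearMap.id ∧
        a.op N ∘ₗ LinearMap.adjoint (a.op N) = (r : ℂ) • LinearMap.id) ∧
      Nonempty (a.NiceGrid D M) ∧ ∀ NI : a.NiceGrid D M,
        -- every Borel set is measurable for `μ*`, and `μ` is the restriction of `μ*`
        (∀ X : Set ℂ, MeasurableSet X → NI.outer.IsCaratheodory X) ∧
        (∀ X : Set (square M), MeasurableSet X → NI.measure X = NI.outer (Subtype.val '' X)) ∧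
        -- the values of the extended maps on polynomials, and `A_D` is multiplication by `z`
        (∀ P, NI.Fm (NI.polyL2 P) = a.FmPoly D P) ∧
        (∀ P, (∀ᶠ N in Filter.atTop, polyVec A φ P ∈ HN A φ N) ∧
          Gm A φ D (polyVec A φ P) = GmPoly A φ D P) ∧
        (∀ f : NI.L2, NI.AD f =ᵐ[NI.measure] fun z => (z : ℂ) * f z) ∧
        ∃ (Φ : NI.L2 ≃ₗᵢ[ℂ] HIm A φ D) (Γ : H ≃ₗᵢ[ℂ] HIm A φ D) (G : NI.L2 ≃ₗᵢ[ℂ] H),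
          (∀ f, (Φ f : Hm A φ D) = NI.Fm f) ∧
          (∀ ψ, (Γ ψ : Hm A φ D) = Gm A φ D ψ) ∧
          (∀ v : HIm A φ D, a.Am D v = Φ (NI.AD (Φ.symm v))) ∧
          (∀ f, G f = Γ.symm (Φ f)) ∧
          (∀ ψ, A ψ = G (NI.AD (G.symm ψ))) := by
  have hDtop := le_atTop_of_mem hD
  have hAr' : A * ContinuousLinearMap.adjoint A = (r : ℂ) • 1 :=
    (mul_adjoint_of_smul_unitary hA).trans hAr
  refine ⟨nonempty_approx hr hAr, fun a => ⟨fun N => ⟨adjoint_AN_comp_AN hr hAr (a.V N),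
    AN_comp_adjoint_AN hr hAr (a.V N)⟩, ?_⟩⟩
  obtain ⟨ν, hν⟩ := a.exists_isWeakLimit D hφ hr hAr
  refine ⟨hν.nonempty_niceGrid hφ hr hAr hMr, fun NI => ?_⟩
  have hGdense : DenseRange (polyVec A φ) := hcyc
  have hFdense := NI.denseRange_polyL2
  have hFnorm := NI.norm_FmPoly hν (NI.measureC_eq hν hφ hr hAr hMr)
  have hGnorm := norm_GmPoly (A := A) (φ := φ) hDtop
  have hFG := a.FmPoly_eq_GmPoly hr hAr hAr' hDtop
  have hF : ∀ P, NI.Fm (NI.polyL2 P) = a.FmPoly D P :=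
    LinearMap.extendOfNorm_eq hFdense ⟨1, fun P => by rw [hFnorm, one_mul]⟩
  have hG : ∀ P, Gm A φ D (polyVec A φ P) = GmPoly A φ D P :=
    LinearMap.extendOfNorm_eq hGdense ⟨1, fun P => by rw [hGnorm, one_mul]⟩
  have hFiso : ∀ f, ‖NI.Fm f‖ = ‖f‖ := LinearMap.norm_extendOfNorm_eq hFdense hFnorm
  have hGiso : ∀ ψ, ‖Gm A φ D ψ‖ = ‖ψ‖ := LinearMap.norm_extendOfNorm_eq hGdense hGnorm
  have hAD : ∀ P, NI.AD (NI.polyL2 P) = NI.polyL2 (MvPolynomial.X 0 * P) := fun P => by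
    rw [NI.AD_eq_mulZ, NI.mulZ_polyL2]
  -- On polynomials $A^m$, $A_D$ and $A$ all act as $P\mapsto XP$; density and continuity spread the
  -- two intertwining relations to the whole spaces.
  have hAF : ∀ f, a.Am D (NI.Fm f) = NI.Fm (NI.AD f) := fun f =>
    hFdense.induction_on (p := fun f => a.Am D (NI.Fm f) = NI.Fm (NI.AD f)) f
      (isClosed_eq (by fun_prop) (by fun_prop)) fun P => by
        rw [hF, hAD, hF, a.Am_FmPoly]
  have hAG : ∀ ψ, a.Am D (Gm A φ D ψ) = Gm A φ D (A ψ) := fun ψ =>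
    hGdense.induction_on (p := fun ψ => a.Am D (Gm A φ D ψ) = Gm A φ D (A ψ)) ψ
      (isClosed_eq (by fun_prop) (by fun_prop)) fun P => by
        rw [hG, ← polyVec_X_mul, hG, ← hFG, a.Am_FmPoly]
  have hFGm : ∀ P, NI.Fm (NI.polyL2 P) = Gm A φ D (polyVec A φ P) := fun P => by rw [hF, hG, hFG]
  have hrange : LinearMap.range NI.Fm.toLinearMap = HIm A φ D := le_antisymm
    (ContinuousLinearMap.range_le_range_of_dense hFdense hGiso hFGm)
    (ContinuousLinearMap.range_le_range_of_dense hGdense hFiso fun P => (hFGm P).symm)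
  obtain ⟨Φ, hΦ⟩ := NI.Fm.exists_linearIsometryEquiv_range hFiso hrange
  obtain ⟨Γ, hΓ⟩ := (Gm A φ D).exists_linearIsometryEquiv_range hGiso
    (S := HIm A φ D) rfl
  refine ⟨fun X hX => NI.borel_le_caratheodory X hX, fun X hX => NI.measure_apply hX, hF,
    fun P => ⟨eventually_polyVec_mem P, hG P⟩, fun f => ?_, Φ, Γ, Φ.trans Γ.symm, hΦ, hΓ,
    fun v => ?_, fun f => rfl, fun ψ => ?_⟩
  · rw [NI.AD_eq_mulZ]
    exact NI.mulZ_ae_eq f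
  · rw [hΦ, ← hAF, ← hΦ, Φ.apply_symm_apply]
  -- After applying $\Gamma$ both sides become $A^m(G^m\psi)$.
  · refine Γ.injective (Subtype.ext ?_)
    change _ = ((Γ (Γ.symm (Φ (NI.AD (Φ.symm (Γ ψ))))) : HIm A φ D) : Hm A φ D)
    rw [Γ.apply_symm_apply, hΦ, ← hAF, ← hΦ, Φ.apply_symm_apply, hΓ, hΓ, hAG]
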